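/- Fix integers $r\ge 1$, $g\ge 0$, $n\ge 1$ and $\mu=(\mu_1,\dots,\mu_n)$ with all $\mu_i\ge 1$. Put $d=\mu_1+\cdots+\mu_n$ and, when $r\mid d$, $s=2g-2+\frac dr+n$. **Graphs.** An $r$-Hurwitz graph $(\gamma,D)$ of type $(g,n,d)$ with dot numbers $\mu$ is the $1$-skeleton $\gamma$ of a cell decomposition of a connected compact oriented surface of genus $g$, with $n$ labelled vertices, together with a configuration $D$ of $d$ dots in the corners of the faces (the dots in one corner being ordered along the counter-clockwise perimeter of the face), such that every face has exactly $r$ dots, vertex $i$ has exactly $\mu_i$ dots, and, if an edge bounds the same face twice, the number $r'$ of dots met on the perimeter of the face between its two occurrences satisfies $0<r'<r$. Then $\gamma$ has $d/r$ faces and $s$ edges. An arrowed $r$-Hurwitz graph carries, in addition, an arrow at one of the $\mu_i$ dots of vertex $i$, for each $i$. A labelling of the $s$ edges by $1,\dots,s$ is admissible if, whenever two edges are consecutive on the counter-clockwise perimeter of a face and there is no dot in the corner between them, their labels are increasing. Faces, edges and dots carry no labels, and isomorphisms preserve the orientation, the vertex labels, the dots and the arrows. Let $$ \mathcal H^r_{g,n}(\mu)=\sum_{\Gamma}\frac{1}{|\mathrm{Aut}\,\Gamma|}\cdot\frac{\#\{\text{admissible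 edge labellings of }\Gamma\}}{s!}, $$ the sum being over isomorphism classes of arrowed $r$-Hurwitz graphs $\Gamma$ of type $(g,n,d)$ with dot numbers $\mu$. Equivalently, $\mathcal H^r_{g,n}(\mu)$ is $\frac1{s!}$ times the automorphism-weighted number of arrowed $r$-Hurwitz graphs with admissibly labelled edges. **Covers.** Let $H^r_{g,n}(\mu)$ be the orbifold Hurwitz number: $\frac1{s!}$ times the number, each weighted by $1/|\mathrm{Aut}|$, of isomorphism classes of connected branched covers of $\mathbb P^1$ of genus $g$ and degree $d$ with profile $(r,\dots,r)$ over $0$, with $n$ labelled points over $\infty$ of ramification orders $\mu_1,\dots,\mu_n$, and with simple ramification over $s$ fixed further points; covers are described by their monodromy. Both numbers are $0$ if $r\nmid d$. **Theorem.** $$ \mathcal H^r_{g,n}(\mu_1,\dots,\mu_n)=\mu_1\mu_2\cdots\mu_n\,H^r_{g,n}(\mu_1,\dots,\mu_n). $$ -/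

import Mathlib

namespace OrbifoldHurwitz

/-- The set of cycles (fixed points included) of a permutation. -/
abbrev Cycles {X : Type} (σ : Equiv.Perm X) : Type :=
  Quotient (Equiv.Perm.SameCycle.setoid σ)

/-! ### Cell graphs with dots -/

/-- A connected cell graph on a compact oriented surface, with `n` labelled vertices and with dots
placed in its corners, as a rotation system. `X` is the set of all half-edges and all dots.

* `rot` sends an item (half-edge or dot) to the next one, counter-clockwise, around the vertex at
  which it sits; so the rotation records the cyclic order of the half-edges at every vertex, the
  corner in which every dot lies and the order of the dots inside a corner.
* `opp` exchanges the two halves of every edge and fixes every dot.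
* `vert` is the label of the vertex at which an item sits. -/
structure DottedGraph (n : ℕ) (X : Type) where
  rot : Equiv.Perm X
  opp : Equiv.Perm X
  opp_opp : ∀ x, opp (opp x) = x
  vert : X → Fin n
  vert_surjective : Function.Surjective vert
  vert_eq_iff : ∀ x y, vert x = vert y ↔ rot.SameCycle x y
  connected : ∀ x y, ∃ w ∈ Subgroup.closure ({rot, opp} : Set (Equiv.Perm X)), w x = y

namespace DottedGraph

variable {n : ℕ} {X : Type}

/-- An item is a dot when `opp` fixes it; all other items are half-edges. -/
def IsDot (G : DottedGraph n X) (x : X) : Prop := G.opp x = x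

/-- An edge is a pair of opposite half-edges. -/
def Edge (G : DottedGraph n X) : Type :=
  {e : Sym2 X // ∃ x, ¬ G.IsDot x ∧ e = s(x, G.opp x)}

/-- The edge to which a half-edge belongs. -/
def edgeOf (G : DottedGraph n X) (x : X) (hx : ¬ G.IsDot x) : G.Edge :=
  ⟨s(x, G.opp x), x, hx, rfl⟩

/-- The successor of an item on the perimeter of its face, the face being kept on the left
(counter-clockwise orientation of the face). Each half-edge lies on the face to its left when one
leaves its vertex along it. After a dot comes the next item clockwise around the same vertex; after
a half-edge one walks to the other end of the edge, and continues with the next item clockwise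
around the vertex there. -/
def face (G : DottedGraph n X) : Equiv.Perm X := G.rot⁻¹ * G.opp

/-- The faces. -/
abbrev Face (G : DottedGraph n X) : Type := Cycles G.face

/-- The graph has genus `g`: vertices minus edges plus faces is `2 - 2g`. -/
def HasGenus (G : DottedGraph n X) (g : ℕ) : Prop :=
  (n : ℤ) - (Nat.card G.Edge : ℤ) + (Nat.card G.Face : ℤ) = 2 - 2 * (g : ℤ)

end DottedGraph

/-- An `r`-Hurwitz graph of genus `g` whose vertex `i` carries `μ i` dots. -/
structure HurwitzGraph (r g : ℕ) {n : ℕ} (μ : Fin n → ℕ) (X : Type) extends DottedGraph n X where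
  hasGenus : toDottedGraph.HasGenus g
  /-- every face has `r` dots -/
  dots_face : ∀ x, Nat.card {y // toDottedGraph.IsDot y ∧ toDottedGraph.face.SameCycle x y} = r
  /-- vertex `i` has `μ i` dots -/
  dots_vert : ∀ i, Nat.card {y // toDottedGraph.IsDot y ∧ vert y = i} = μ i
  /-- If the edge of `x` bounds the same face twice, then on the perimeter of the face the number
  of dots met on the way from `x` to the opposite half-edge is strictly between `0` and `r`. -/
  dots_between : ∀ (x : X) (k : ℕ), ¬ toDottedGraph.IsDot x →
    (toDottedGraph.face ^ k) x = opp x →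
    (∀ j < k, (toDottedGraph.face ^ j) x ≠ opp x) →
    0 < Nat.card {j : ℕ // j < k ∧ toDottedGraph.IsDot ((toDottedGraph.face ^ j) x)} ∧
      Nat.card {j : ℕ // j < k ∧ toDottedGraph.IsDot ((toDottedGraph.face ^ j) x)} < r

/-- An arrowed `r`-Hurwitz graph: at every vertex an arrow is attached to one of its dots. -/
structure ArrowedGraph (r g : ℕ) {n : ℕ} (μ : Fin n → ℕ) (X : Type)
    extends HurwitzGraph r g μ X where
  arrow : Fin n → X
  arrow_isDot : ∀ i, toDottedGraph.IsDot (arrow i)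
  vert_arrow : ∀ i, vert (arrow i) = i

namespace ArrowedGraph

variable {r g n : ℕ} {μ : Fin n → ℕ} {X : Type}

/-- `π` is an isomorphism of arrowed graphs: it preserves the rotation, the edges, the dots, the
labels of the vertices and the arrows. -/
def IsIso (π : Equiv.Perm X) (G G' : ArrowedGraph r g μ X) : Prop :=
  (∀ x, π (G.rot x) = G'.rot (π x)) ∧ (∀ x, π (G.opp x) = G'.opp (π x)) ∧
    (∀ x, G.vert x = G'.vert (π x)) ∧ ∀ i, π (G.arrow i) = G'.arrow i

instance isoSetoid (r g : ℕ) {n : ℕ} (μ : Fin n → ℕ) (X : Type) :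
    Setoid (ArrowedGraph r g μ X) where
  r G G' := ∃ π, IsIso π G G'
  iseqv :=
    { refl := fun G => ⟨1, by simp [IsIso]⟩
      symm := by
        rintro G G' ⟨π, h1, h2, h3, h4⟩
        refine ⟨π⁻¹, fun x => ?_, fun x => ?_, fun x => ?_, fun i => ?_⟩
        · rw [Equiv.Perm.inv_eq_iff_eq, h1]; simp
        · rw [Equiv.Perm.inv_eq_iff_eq, h2]; simp
        · rw [h3]; simp
        · rw [Equiv.Perm.inv_eq_iff_eq, h4]
      trans := by
        rintro G G' G'' ⟨π, h1, h2, h3, h4⟩ ⟨ρ, k1, k2, k3, k4⟩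
        exact ⟨ρ * π, fun x => by simp [h1, k1], fun x => by simp [h2, k2],
          fun x => by simp [h3, k3], fun i => by simp [h4, k4]⟩ }

/-- The automorphisms of an arrowed graph. -/
def Aut (G : ArrowedGraph r g μ X) : Type := {π : Equiv.Perm X // IsIso π G G}

/-- The admissible labellings of the edges by `1, …, s` (the exponents of the branch points
`ξ ^ 1, …, ξ ^ s`): bijections such that two edges that follow each other on the perimeter of a
face, with no dot in the corner between them, have increasing labels. -/
def EdgeLabeling (G : ArrowedGraph r g μ X) (s : ℕ) : Type :=
  {l : G.Edge ≃ Fin s // ∀ (x : X) (hx : ¬ G.IsDot x) (hy : ¬ G.IsDot (G.face x)),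
    l (G.edgeOf x hx) < l (G.edgeOf (G.face x) hy)}

instance [Finite X] : Finite (ArrowedGraph r g μ X) := by
  refine Finite.of_injective
    (fun G => (G.rot, G.opp, G.vert, G.arrow) :
      ArrowedGraph r g μ X → Equiv.Perm X × Equiv.Perm X × (X → Fin n) × (Fin n → X)) ?_
  rintro ⟨⟨⟨a, b, _, c, _, _, _⟩, _, _, _, _⟩, d, _, _⟩
    ⟨⟨⟨a', b', _, c', _, _, _⟩, _, _, _, _⟩, d', _, _⟩ h
  simp only [Prod.mk.injEq] at h
  obtain ⟨rfl, rfl, rfl, rfl⟩ := h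
  rfl

end ArrowedGraph

/-- The number `s = 2g - 2 + d/r + n` with `d = ∑ μ i`, of edges of the graphs and of simple
branch points of the covers. (For `n ≥ 1`, `d ≥ 1` and `r ∣ d` the subtraction is a true one; if
`r` does not divide `d` there are no graphs and no covers.) -/
def edgeNumber (r g : ℕ) {n : ℕ} (μ : Fin n → ℕ) : ℕ := 2 * g + (∑ i, μ i) / r + n - 2

/-- The weighted number of arrowed `r`-Hurwitz graphs: the sum over the isomorphism classes of
such graphs (with `s` edges, hence `2s` half-edges, and `d` dots) of `1 / |Aut|` times the
proportion of admissible labellings among the `s!` labellings of the edges. -/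
noncomputable def graphNumber (r g : ℕ) {n : ℕ} (μ : Fin n → ℕ) : ℚ :=
  ∑ᶠ c : Quotient (ArrowedGraph.isoSetoid r g μ (Fin (2 * edgeNumber r g μ + ∑ i, μ i))),
    (Nat.card (c.out.EdgeLabeling (edgeNumber r g μ)) : ℚ) /
      ((Nat.card c.out.Aut : ℚ) * ((edgeNumber r g μ).factorial : ℚ))

/-! ### Orbifold Hurwitz numbers -/

/-- A connected branched cover of the sphere of genus `g`, with set of sheets `S`, given by its
monodromy: profile `(r, …, r)` over `0`, labelled profile `μ` over `∞`, and simple ramification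
over `s` further labelled points. `pt` names the point over `∞` to which a sheet belongs. -/
structure Cover (r g : ℕ) {n : ℕ} (μ : Fin n → ℕ) (s : ℕ) (S : Type) [DecidableEq S] where
  zero : Equiv.Perm S
  simple : Fin s → Equiv.Perm S
  infty : Equiv.Perm S
  prod_eq_one : zero * (List.ofFn simple).prod * infty = 1
  connected : ∀ x y, ∃ w ∈ Subgroup.closure ({zero, infty} ∪ Set.range simple), w x = y
  card_zero : ∀ x, Nat.card {y // zero.SameCycle x y} = r
  isSwap_simple : ∀ a, (simple a).IsSwap
  pt : S → Fin n
  pt_surjective : Function.Surjective pt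
  pt_eq_iff : ∀ x y, pt x = pt y ↔ infty.SameCycle x y
  card_pt : ∀ i, Nat.card {x // pt x = i} = μ i
  /-- the genus is `g`, by the Riemann-Hurwitz formula -/
  riemann_hurwitz : 2 - 2 * (g : ℤ) = 2 * (Nat.card S : ℤ)
    - ((Nat.card S : ℤ) - (Nat.card (Cycles zero) : ℤ))
    - (∑ a, ((Nat.card S : ℤ) - (Nat.card (Cycles (simple a)) : ℤ)))
    - ((Nat.card S : ℤ) - (Nat.card (Cycles infty) : ℤ))

namespace Cover

variable {r g n : ℕ} {μ : Fin n → ℕ} {s : ℕ} {S : Type} [DecidableEq S]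

/-- `π` is an isomorphism of covers over the identity of the sphere, preserving the labels of the
points over `∞`. -/
def IsIso (π : Equiv.Perm S) (C C' : Cover r g μ s S) : Prop :=
  (∀ x, π (C.zero x) = C'.zero (π x)) ∧ (∀ a x, π (C.simple a x) = C'.simple a (π x)) ∧
    (∀ x, π (C.infty x) = C'.infty (π x)) ∧ ∀ x, C.pt x = C'.pt (π x)

instance isoSetoid (r g : ℕ) {n : ℕ} (μ : Fin n → ℕ) (s : ℕ) (S : Type) [DecidableEq S] :
    Setoid (Cover r g μ s S) where
  r C C' := ∃ π, IsIso π C C'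
  iseqv :=
    { refl := fun C => ⟨1, by simp [IsIso]⟩
      symm := by
        rintro C C' ⟨π, h1, h2, h3, h4⟩
        refine ⟨π⁻¹, fun x => ?_, fun a x => ?_, fun x => ?_, fun x => ?_⟩
        · rw [Equiv.Perm.inv_eq_iff_eq, h1]; simp
        · rw [Equiv.Perm.inv_eq_iff_eq, h2]; simp
        · rw [Equiv.Perm.inv_eq_iff_eq, h3]; simp
        · rw [h4]; simp
      trans := by
        rintro C C' C'' ⟨π, h1, h2, h3, h4⟩ ⟨ρ, k1, k2, k3, k4⟩
        exact ⟨ρ * π, fun x => by simp [h1, k1], fun a x => by simp [h2, k2],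
          fun x => by simp [h3, k3], fun x => by simp [h4, k4]⟩ }

/-- The automorphisms of a cover. -/
def Aut (C : Cover r g μ s S) : Type := {π : Equiv.Perm S // IsIso π C C}

instance [Finite S] : Finite (Cover r g μ s S) := by
  refine Finite.of_injective
    (fun C => (C.zero, C.simple, C.infty, C.pt) :
      Cover r g μ s S → Equiv.Perm S × (Fin s → Equiv.Perm S) × Equiv.Perm S × (S → Fin n)) ?_
  rintro ⟨a, b, c, _, _, _, _, d, _, _, _, _⟩ ⟨a', b', c', _, _, _, _, d', _, _, _, _⟩ h
  simp only [Prod.mk.injEq] at h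
  obtain ⟨rfl, rfl, rfl, rfl⟩ := h
  rfl

end Cover

/-- The orbifold Hurwitz number: the number of covers of degree `d = ∑ μ i` with
`s = 2g - 2 + d/r + n` labelled simple branch points, each isomorphism class being counted with
weight `1 / |Aut|`, divided by the number `s!` of labellings of the simple branch points. -/
noncomputable def hurwitzNumber (r g : ℕ) {n : ℕ} (μ : Fin n → ℕ) : ℚ :=
  (∑ᶠ c : Quotient (Cover.isoSetoid r g μ (edgeNumber r g μ) (Fin (∑ i, μ i))),
    1 / (Nat.card c.out.Aut : ℚ)) / ((edgeNumber r g μ).factorial : ℚ)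

end OrbifoldHurwitz

namespace OrbifoldHurwitz

/-! Admissibly labelled graphs are another notation for monodromy. Give the dots the label 0 and the
edges the labels `1, …, s`. Admissibility says that labels strictly decrease along `rot` until a dot
is reached. So an item is determined by the first dot `b` that `rot` reaches from it and by its
label `k`. Taking the dots as sheets, the items become the pairs `(b, k)` with `k = 0` or with `b`
moved by the `k`-th transposition. In these coordinates `opp` sends `(b, k)` to `(τ_k b, k)`; `rot`
descends through the labels at `b` and, from the dot, jumps to the top label at `infty b`. These
rules are recorded in `Compat`; `exists_monodromy` and `exists_rotation` pass between the two sides,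
and each side determines the other (`rotation_eq`, `monodromy_eq`).

The remaining data then match. Vertices are the cycles of `infty` (`sameCycle_rot_iff`).
Transporting `(b, k)` by `τ_1 ⋯ τ_(k-1)` gives a sheet that is constant along a face between dots
and changes by `zero` on arrival at a dot, so faces are the cycles of `zero` (`sameCycle_face_iff`).
Euler's formula becomes Riemann-Hurwitz, and transitivity is the same on both sides. The condition
on an edge that bounds a face twice follows from the existence of an admissible labelling
(`Compat.dots_between`).

Automorphisms are avoided by naming everything. With `d` the number of dots, orbit counting
(`finsum_quotient_div_card_aut`) turns the weighted sums into counts on fixed sets, divided by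
`(2s+d)!` for graphs and by `d!` for covers. The correspondence, with both dots and items named,
gives (labelled graphs) · `d!` = (covers) · `(2s+d)!`. On named graphs the arrows are free choices,
whence the factor `∏ μ i`. -/

open Equiv

/-! ### Permutations -/

/-- If `F` semiconjugates `f` to `z`, except that `F` stays constant until `f` reaches the section
`P` of `F`, then the cycles of `f` are those of `z`. -/
theorem sameCycle_iff_of_section {X S : Type} [Finite X] [Finite S] {f : Perm X} {z : Perm S}
    {F : X → S} {ι : S → X} {P : X → Prop} (hι : ∀ x, P x → ι (F x) = x)
    (hF : ∀ d, F (ι d) = d) (h1 : ∀ x, ¬ P (f x) → F (f x) = F x)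
    (h2 : ∀ x, P (f x) → F (f x) = z (F x)) (h3 : ∀ x, ∃ k, P ((f ^ k) x)) (x y : X) :
    f.SameCycle x y ↔ z.SameCycle (F x) (F y) := by
  have hs : ∀ x, z.SameCycle (F x) (F (f x)) := fun x => by
    by_cases h : P (f x)
    · exact ⟨1, by simp [h2 x h]⟩
    · rw [h1 x h]
  -- Until its next visit to `P` the orbit of `x` keeps the value `F x`; at the visit the value
  -- becomes `z (F x)`, so the point visited is `ι (z (F x))`.
  have hA : ∀ (k : ℕ) (x : X), P ((f ^ k) (f x)) → f.SameCycle x (ι (z (F x))) := by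
    intro k
    induction k with
    | zero =>
      intro x hx
      have hx' : P (f x) := by simpa using hx
      rw [← h2 x hx', hι _ hx']
      exact ⟨1, by simp⟩
    | succ k ih =>
      intro x hx
      by_cases h : P (f x)
      · rw [← h2 x h, hι _ h]
        exact ⟨1, by simp⟩
      · have := ih (f x) (by rwa [pow_succ, Perm.mul_apply] at hx)
        rw [h1 x h] at this
        exact (show f.SameCycle x (f x) from ⟨1, by simp⟩).trans this
  have hA' : ∀ x, f.SameCycle x (ι (z (F x))) := fun x => by
    obtain ⟨k, hk⟩ := h3 (f x)
    exact hA k x hk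
  have hB : ∀ d, f.SameCycle (ι d) (ι (z d)) := fun d => by
    have := hA' (ι d)
    rwa [hF] at this
  have hC : ∀ (i : ℕ) d, f.SameCycle (ι d) (ι ((z ^ i) d)) := by
    intro i
    induction i with
    | zero => intro d; exact Perm.SameCycle.refl _ _
    | succ i ih =>
      intro d
      rw [pow_succ', Perm.mul_apply]
      exact (ih d).trans (hB _)
  -- Both `x` and `ι (F x)` flow to `ι (z (F x))`.
  have hD : ∀ x, f.SameCycle x (ι (F x)) := fun x => (hA' x).trans (hB _).symm
  constructor
  · intro h
    obtain ⟨i, rfl⟩ := h.exists_nat_pow_eq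
    clear h
    induction i with
    | zero => exact Perm.SameCycle.refl _ _
    | succ i ih =>
      rw [pow_succ', Perm.mul_apply]
      exact ih.trans (hs _)
  · intro h
    obtain ⟨i, hi⟩ := h.exists_nat_pow_eq
    refine (hD x).trans (Perm.SameCycle.trans ?_ (hD y).symm)
    rw [← hi]
    exact hC i _

/-- A set of permutations generates a transitive group if and only if the invariant predicates
are constant. -/
theorem transitive_iff_invariant {X : Type} (T : Set (Perm X)) :
    (∀ x y, ∃ w ∈ Subgroup.closure T, w x = y) ↔
      ∀ P : X → Prop, (∀ t ∈ T, ∀ x, P (t x) ↔ P x) → ∀ x y, P x → P y := by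
  constructor
  · intro h P hP x y hx
    obtain ⟨w, hw, rfl⟩ := h x y
    have key : ∀ x, P (w x) ↔ P x := by
      induction hw using Subgroup.closure_induction with
      | mem t ht => exact hP t ht
      | one => simp
      | mul a b _ _ ha hb => intro x; rw [Perm.mul_apply, ha, hb]
      | inv a _ ha => intro x; rw [← ha]; simp
    exact (key x).2 hx
  · intro h x y
    refine h (fun y => ∃ w ∈ Subgroup.closure T, w x = y) ?_ x y ⟨1, one_mem _, rfl⟩
    intro t ht z
    constructor
    · rintro ⟨w, hw, hz⟩
      exact ⟨t⁻¹ * w, mul_mem (inv_mem (Subgroup.subset_closure ht)) hw, by simp [hz]⟩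
    · rintro ⟨w, hw, rfl⟩
      exact ⟨t * w, mul_mem (Subgroup.subset_closure ht) hw, rfl⟩

theorem sameCycle_swap_iff {S : Type} [DecidableEq S] {a b x y : S} :
    (swap a b).SameCycle x y ↔ x = y ∨ swap a b x = y := by
  constructor
  · rintro ⟨i, rfl⟩
    have h2 : swap a b ^ 2 = 1 := by rw [pow_two, swap_mul_self]
    obtain ⟨j, rfl | rfl⟩ := Int.even_or_odd' i
    · left; simp [zpow_mul, h2]
    · right; simp [zpow_add, zpow_mul, h2]
  · rintro (rfl | rfl)
    · exact Perm.SameCycle.refl _ _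
    · exact ⟨1, by simp⟩

theorem card_cycles_of_isSwap {S : Type} [Finite S] [DecidableEq S] {τ : Perm S} (h : τ.IsSwap) :
    Nat.card (Cycles τ) + 1 = Nat.card S := by
  obtain ⟨a, b, hab, rfl⟩ := h
  -- Every cycle of `swap a b` has exactly one representative other than `b`.
  have e : {x : S // x ≠ b} ≃ Cycles (swap a b) := by
    refine Equiv.ofBijective (fun x => Quotient.mk _ x.1) ⟨?_, ?_⟩
    · rintro ⟨x, hx⟩ ⟨y, hy⟩ hxy
      have := sameCycle_swap_iff.1 (Quotient.exact hxy)
      rcases this with h | h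
      · exact Subtype.ext h
      · rw [Subtype.mk.injEq]
        change swap a b x = y at h
        by_cases hxa : x = a
        · subst hxa; simp at h; exact absurd h.symm hy
        · rwa [swap_apply_of_ne_of_ne hxa hx] at h
    · intro q
      induction q using Quotient.inductionOn with
      | h x =>
        by_cases hx : x = b
        · subst hx
          refine ⟨⟨a, hab⟩, Quotient.sound ?_⟩
          exact sameCycle_swap_iff.2 (Or.inr (by simp))
        · exact ⟨⟨x, hx⟩, rfl⟩
  rw [← Nat.card_congr e]
  have := Fintype.ofFinite S
  rw [Nat.card_eq_fintype_card, Nat.card_eq_fintype_card, Fintype.card_subtype_compl]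
  simp only [Fintype.card_unique]
  have : 0 < Fintype.card S := Fintype.card_pos_iff.2 ⟨b⟩
  omega

/-! ### Weighted counting of isomorphism classes -/

/-- Orbit counting for a finite group `Γ` acting on `A` through a relation `R π a b` to be read as
"`π` carries `a` to `b`". -/
theorem finsum_quotient_div_card_aut {Γ A : Type} [Group Γ] [Finite Γ] [Finite A] (st : Setoid A)
    (R : Γ → A → A → Prop) (hst : ∀ a b, st a b ↔ ∃ π, R π a b)
    (hex : ∀ π a, ∃ b, R π a b) (huniq : ∀ π a b b', R π a b → R π a b' → b = b')
    (hinv : ∀ π a b, R π a b → R π⁻¹ b a)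
    (hmul : ∀ π ρ a b c, R π a b → R ρ b c → R (ρ * π) a c)
    (f : A → ℚ) (hf : ∀ π a b, R π a b → f a = f b) :
    ∑ᶠ c : Quotient st, f c.out / (Nat.card {π // R π c.out c.out} : ℚ) =
      (∑ᶠ a, f a) / (Nat.card Γ : ℚ) := by
  classical
  have := Fintype.ofFinite A
  have := Fintype.ofFinite Γ
  have := Fintype.ofFinite (Quotient st)
  rw [finsum_eq_sum_of_fintype, finsum_eq_sum_of_fintype]
  have hcard : ∀ a, Nat.card Γ = Nat.card {b // st a b} * Nat.card {π // R π a a} := by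
    intro a
    choose t ht using hex
    -- Orbit-stabilizer: with a chosen `ρ b` carrying `a` to `b`, each `π` that carries `a` to `b`
    -- is `ρ b` times a unique automorphism of `a`.
    have e : Γ ≃ {b // st a b} × {π // R π a a} := by
      have hch : ∀ b : {b // st a b}, ∃ π, R π a b := fun b => (hst _ _).1 b.2
      choose ρ hρ using hch
      refine
        { toFun := fun π => (⟨t π a, (hst _ _).2 ⟨π, ht _ _⟩⟩,
            ⟨(ρ ⟨t π a, (hst _ _).2 ⟨π, ht _ _⟩⟩)⁻¹ * π,
              hmul _ _ _ _ _ (ht π a) (hinv _ _ _ (hρ ⟨t π a, (hst _ _).2 ⟨π, ht _ _⟩⟩))⟩)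
          invFun := fun p => ρ p.1 * p.2.1
          left_inv := fun π => by simp
          right_inv := ?_ }
      rintro ⟨⟨b, hb⟩, ⟨π, hπ⟩⟩
      have : t (ρ ⟨b, hb⟩ * π) a = b :=
        huniq _ _ _ _ (ht _ _) (hmul _ _ _ _ _ hπ (hρ ⟨b, hb⟩))
      simp [this]
    rw [Nat.card_congr e, Nat.card_prod]
  have hΓ : (Nat.card Γ : ℚ) ≠ 0 := by
    have : 0 < Nat.card Γ := Nat.card_pos
    positivity
  have hsum : ∑ a, f a = ∑ c : Quotient st, f c.out * Nat.card {b // st c.out b} := by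
    rw [← Finset.sum_fiberwise (s := Finset.univ) (g := fun a => (Quotient.mk st a))]
    refine Finset.sum_congr rfl fun c _ => ?_
    have h1 : ∀ a ∈ Finset.univ.filter (fun a => Quotient.mk st a = c), f a = f c.out := by
      intro a ha
      simp only [Finset.mem_filter, Finset.mem_univ, true_and] at ha
      have : st a c.out := Quotient.exact (by rw [ha, Quotient.out_eq])
      obtain ⟨π, hπ⟩ := (hst _ _).1 this
      exact hf _ _ _ hπ
    rw [Finset.sum_congr rfl h1, Finset.sum_const, nsmul_eq_mul, mul_comm,
      Nat.card_eq_fintype_card, Fintype.card_subtype]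
    congr 3
    ext a
    simp only [Finset.mem_filter, Finset.mem_univ, true_and]
    constructor
    · rintro rfl
      exact Quotient.mk_out (s := st) a
    · intro h
      rw [← Quotient.out_eq c]
      exact (Quotient.sound h).symm
  rw [hsum, Finset.sum_div]
  refine Finset.sum_congr rfl fun c _ => ?_
  have h := hcard c.out
  have h' : (Nat.card Γ : ℚ) = Nat.card {b // st c.out b} * Nat.card {π // R π c.out c.out} := by
    exact_mod_cast h
  rw [h'] at hΓ ⊢
  have h1 := left_ne_zero_of_mul hΓ
  have h2 := right_ne_zero_of_mul hΓ
  field_simp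

/-- A relation that is total and injective on both sides relates sets of the same size. -/
theorem card_eq_of_relation {A B : Type} [Finite A] [Finite B] (R : A → B → Prop)
    (h1 : ∀ a, ∃ b, R a b) (h2 : ∀ b, ∃ a, R a b) (h3 : ∀ a a' b, R a b → R a' b → a = a')
    (h4 : ∀ a b b', R a b → R a b' → b = b') : Nat.card A = Nat.card B := by
  choose u hu using h1
  choose v hv using h2
  exact le_antisymm
    (Nat.card_le_card_of_injective u fun a a' h => h3 _ _ _ (hu a) (h ▸ hu a'))
    (Nat.card_le_card_of_injective v fun b b' h => h4 _ _ _ (hv b) (h ▸ hv b'))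

/-! ### Labelled graphs and their monodromy -/

/-- The monodromy around the `k`-th branch point, the branch points being numbered from `1`; it is
trivial for other numbers. -/
def tau {S : Type} {s : ℕ} (simple : Fin s → Perm S) : ℕ → Perm S
  | 0 => 1
  | k + 1 => if h : k < s then simple ⟨k, h⟩ else 1

section tau

variable {S : Type} {s : ℕ} {simple : Fin s → Perm S}

@[simp] theorem tau_zero : tau simple 0 = 1 := rfl

theorem tau_succ (a : Fin s) : tau simple (a + 1) = simple a := by
  simp [tau]

theorem tau_of_lt {k : ℕ} (h : s < k) : tau simple k = 1 := by
  cases k with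
  | zero => rfl
  | succ k => simp [tau, show ¬ k < s by omega]

theorem exists_eq_succ_of_tau_ne {k : ℕ} {b : S} (h : tau simple k b ≠ b) :
    ∃ a : Fin s, k = a + 1 := by
  cases k with
  | zero => simp at h
  | succ k =>
    by_cases hk : k < s
    · exact ⟨⟨k, hk⟩, rfl⟩
    · simp [tau, hk] at h

variable [DecidableEq S]

theorem tau_tau (hs : ∀ a, (simple a).IsSwap) (k : ℕ) (b : S) :
    tau simple k (tau simple k b) = b := by
  by_cases h : tau simple k b = b
  · rw [h, h]
  · obtain ⟨a, rfl⟩ := exists_eq_succ_of_tau_ne h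
    rw [tau_succ]
    obtain ⟨x, y, -, hxy⟩ := hs a
    rw [hxy, swap_apply_self]

/-- A transposition moves only two points; this is why a label belongs to only two half-edges. -/
theorem eq_or_eq_tau (hs : ∀ a, (simple a).IsSwap) {k : ℕ} {b c : S} (hb : tau simple k b ≠ b)
    (hc : tau simple k c ≠ c) : c = b ∨ c = tau simple k b := by
  obtain ⟨a, rfl⟩ := exists_eq_succ_of_tau_ne hb
  rw [tau_succ] at *
  obtain ⟨x, y, hne, hxy⟩ := hs a
  rw [hxy] at hb hc ⊢
  rcases eq_or_ne b x with rfl | hbx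
  · rcases eq_or_ne c b with rfl | hcx
    · exact Or.inl rfl
    · rcases eq_or_ne c y with rfl | hcy
      · simp
      · exact absurd (swap_apply_of_ne_of_ne hcx hcy) hc
  · rcases eq_or_ne b y with rfl | hby
    · rcases eq_or_ne c b with rfl | hcx
      · exact Or.inl rfl
      · rcases eq_or_ne c x with rfl | hcy
        · simp
        · exact absurd (swap_apply_of_ne_of_ne hcy hcx) hc
    · exact absurd (swap_apply_of_ne_of_ne hbx hby) hb

end tau

/-- An admissible labelling of the edges by `1, …, s`, as a function on the items which vanishes
at the dots. -/
structure IsKey {n : ℕ} {X : Type} (G : DottedGraph n X) (s : ℕ) (key : X → ℕ) : Prop where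
  eq_zero_iff : ∀ x, key x = 0 ↔ G.IsDot x
  key_opp : ∀ x, key (G.opp x) = key x
  le : ∀ x, key x ≤ s
  exists_key : ∀ a : Fin s, ∃ x, key x = a + 1
  eq_or_eq_opp : ∀ x y, key x ≠ 0 → key x = key y → y = x ∨ y = G.opp x
  key_rot_lt : ∀ x, key x ≠ 0 → key (G.rot x) < key x

/-- The rotation system `(rot, opp)` with the edge labels `key` and the dots `ι d` is the one that
belongs to the monodromy `(simple, infty)`: an item is given by the first dot `base x` that comes
before it (counter-clockwise) and by its label `key x`. -/
structure Compat {X S : Type} {s : ℕ} (rot opp : Perm X) (key : X → ℕ) (ι : S → X)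
    (simple : Fin s → Perm S) (infty : Perm S) (base : X → S) : Prop where
  inj : ∀ x y, base x = base y → key x = key y → x = y
  exists_item : ∀ b k, tau simple k b ≠ b → ∃ x, base x = b ∧ key x = k
  tau_ne : ∀ x, key x ≠ 0 → tau simple (key x) (base x) ≠ base x
  base_dot : ∀ d, base (ι d) = d
  key_dot : ∀ d, key (ι d) = 0
  base_opp : ∀ x, base (opp x) = tau simple (key x) (base x)
  key_opp : ∀ x, key (opp x) = key x
  base_rot : ∀ x, key x ≠ 0 → base (rot x) = base x
  key_rot_lt : ∀ x, key x ≠ 0 → key (rot x) < key x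
  base_rot_dot : ∀ x, key x = 0 → base (rot x) = infty (base x)
  le_key_rot : ∀ x y, key x ≠ 0 → base y = base x → key y < key x → key y ≤ key (rot x)
  le_key_rot_dot : ∀ x y, key x = 0 → base y = infty (base x) → key y ≤ key (rot x)

/-- Monodromy determines a rotation system on the set of items. -/
theorem exists_rotation {X S : Type} [Finite X] [DecidableEq S] {s : ℕ} {simple : Fin s → Perm S}
    (hs : ∀ a, (simple a).IsSwap) (infty : Perm S) {base : X → S} {key : X → ℕ} {ι : S → X}
    (inj : ∀ x y, base x = base y → key x = key y → x = y)
    (exists_item : ∀ b k, tau simple k b ≠ b → ∃ x, base x = b ∧ key x = k)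
    (tau_ne : ∀ x, key x ≠ 0 → tau simple (key x) (base x) ≠ base x)
    (base_dot : ∀ d, base (ι d) = d) (key_dot : ∀ d, key (ι d) = 0) :
    ∃ rot opp : Perm X, Compat rot opp key ι simple infty base := by
  classical
  have := Fintype.ofFinite X
  -- A transposition also moves the image of a point that it moves, so the opposite half-edge
  -- exists.
  have hopp : ∀ x, ∃ z, base z = tau simple (key x) (base x) ∧ key z = key x := by
    intro x
    by_cases h : key x = 0
    · exact ⟨x, by simp [h], rfl⟩
    · exact exists_item _ _ fun h' => tau_ne x h (Equiv.injective _ h')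
  choose opp base_opp key_opp using hopp
  have hopp2 : Function.Involutive opp := fun x =>
    inj _ _ (by rw [base_opp, base_opp, key_opp, tau_tau hs]) (by rw [key_opp, key_opp])
  have hrot : ∀ x, ∃ z, (key x ≠ 0 → base z = base x ∧ key z < key x ∧
        ∀ y, base y = base x → key y < key x → key y ≤ key z) ∧
      (key x = 0 → base z = infty (base x) ∧ ∀ y, base y = infty (base x) → key y ≤ key z) := by
    intro x
    by_cases h : key x = 0
    · obtain ⟨z, hz, hmax⟩ := (Finset.univ.filter fun z => base z = infty (base x)).exists_max_image
        key ⟨ι (infty (base x)), by simp [base_dot]⟩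
      simp only [Finset.mem_filter, Finset.mem_univ, true_and] at hz hmax
      exact ⟨z, fun h' => absurd h h', fun _ => ⟨hz, hmax⟩⟩
    · obtain ⟨z, hz, hmax⟩ :=
        (Finset.univ.filter fun z => base z = base x ∧ key z < key x).exists_max_image key
          ⟨ι (base x), by simp [base_dot, key_dot]; omega⟩
      simp only [Finset.mem_filter, Finset.mem_univ, true_and] at hz hmax
      exact ⟨z, fun _ => ⟨hz.1, hz.2, fun y h1 h2 => hmax y ⟨h1, h2⟩⟩, fun h' => absurd h' h⟩
  choose rot hrot1 hrot0 using hrot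
  have hinj : Function.Injective rot := by
    -- If the labels differed, maximality of the common successor would contradict the strict
    -- descent of labels at one of the two items.
    have aux : ∀ x x', rot x = rot x' → key x ≤ key x' → x = x' := by
      intro x x' h hle
      by_cases hx' : key x' = 0
      · have hx : key x = 0 := by omega
        have h1 := (hrot0 x hx).1
        rw [h, (hrot0 x' hx').1] at h1
        exact inj _ _ (infty.injective h1).symm (by omega)
      · obtain ⟨b1, b2, b3⟩ := hrot1 x' hx'
        by_cases hx : key x = 0
        · obtain ⟨c1, c2⟩ := hrot0 x hx
          have := c2 x' (by rw [← c1, h, b1])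
          rw [h] at this
          omega
        · obtain ⟨c1, c2, c3⟩ := hrot1 x hx
          rw [h, b1] at c1
          refine inj _ _ c1.symm (le_antisymm hle ?_)
          by_contra hlt
          have := b3 x c1.symm (by omega)
          rw [h] at c2
          omega
    intro x x' h
    rcases le_total (key x) (key x') with hle | hle
    · exact aux _ _ h hle
    · exact (aux _ _ h.symm hle).symm
  refine ⟨Equiv.ofBijective rot (Finite.injective_iff_bijective.1 hinj), hopp2.toPerm, ?_⟩
  exact
    { inj := inj
      exists_item := exists_item
      tau_ne := tau_ne
      base_dot := base_dot
      key_dot := key_dot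
      base_opp := base_opp
      key_opp := key_opp
      base_rot := fun x hx => (hrot1 x hx).1
      key_rot_lt := fun x hx => (hrot1 x hx).2.1
      base_rot_dot := fun x hx => (hrot0 x hx).1
      le_key_rot := fun x y hx => (hrot1 x hx).2.2 y
      le_key_rot_dot := fun x y hx => (hrot0 x hx).2 y }

/-- A labelled graph has a monodromy on the set of its dots. -/
theorem exists_monodromy {n : ℕ} {X S : Type} [Finite S] [DecidableEq S] {s : ℕ}
    (G : DottedGraph n X) {key : X → ℕ} (hk : IsKey G s key) (ι : S ≃ {x // G.IsDot x}) :
    ∃ (simple : Fin s → Perm S) (infty : Perm S) (base : X → S), (∀ a, (simple a).IsSwap) ∧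
      Compat G.rot G.opp key (fun d => ι d) simple infty base := by
  classical
  have hex : ∀ m x, key x ≤ m → ∃ k, key ((G.rot)^[k] x) = 0 := by
    intro m
    induction m with
    | zero => exact fun x hx => ⟨0, by simpa using hx⟩
    | succ m ih =>
      intro x hx
      by_cases h : key x = 0
      · exact ⟨0, h⟩
      · obtain ⟨k, hk'⟩ := ih (G.rot x) (by have := hk.key_rot_lt x h; omega)
        exact ⟨k + 1, hk'⟩
  replace hex : ∀ x, ∃ k, key ((G.rot)^[k] x) = 0 := fun x => hex _ x le_rfl
  -- `dep x` is the number of steps to the first dot and `b x` is that dot. The pair `(b, dep)`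
  -- clearly determines the item; over a fixed dot the label increases strictly with the depth, so
  -- `(b, key)` does too.
  obtain ⟨dep, hdep⟩ : ∃ dep : X → ℕ, ∀ x, dep x = Nat.find (hex x) := ⟨_, fun _ => rfl⟩
  obtain ⟨b, hb⟩ : ∃ b : X → X, ∀ x, b x = (G.rot)^[dep x] x := ⟨_, fun _ => rfl⟩
  have key_b : ∀ x, key (b x) = 0 := fun x => by rw [hb, hdep]; exact Nat.find_spec (hex x)
  have dep_zero : ∀ x, key x = 0 → dep x = 0 := fun x hx => by
    rw [hdep, Nat.find_eq_zero]; exact hx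
  have b_zero : ∀ x, key x = 0 → b x = x := fun x hx => by rw [hb, dep_zero x hx]; rfl
  have dep_rot : ∀ x, key x ≠ 0 → dep x = dep (G.rot x) + 1 := fun x hx => by
    rw [hdep, hdep]
    exact Nat.find_comp_succ (hex x) (hex (G.rot x)) hx
  have b_rot : ∀ x, key x ≠ 0 → b (G.rot x) = b x := fun x hx => by
    rw [hb x, dep_rot x hx, hb, Function.iterate_succ_apply]
  have key_zero : ∀ x, dep x = 0 → key x = 0 := fun x hx => by
    by_contra h
    have := dep_rot x h
    omega
  have key_ne : ∀ x, dep x ≠ 0 → key x ≠ 0 := fun x hx h => hx (dep_zero x h)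
  have eq_of_dep : ∀ m x y, dep x = m → dep y = m → b x = b y → x = y := by
    intro m
    induction m with
    | zero =>
      intro x y hx hy h
      rwa [b_zero x (key_zero x hx), b_zero y (key_zero y hy)] at h
    | succ m ih =>
      intro x y hx hy h
      have hx' := key_ne x (by omega)
      have hy' := key_ne y (by omega)
      have h1 := dep_rot x hx'
      have h2 := dep_rot y hy'
      exact G.rot.injective (ih _ _ (by omega) (by omega) (by rw [b_rot x hx', b_rot y hy', h]))
  have key_le : ∀ m x y, dep y = dep x + m → b x = b y → key x ≤ key y := by
    intro m
    induction m with
    | zero => exact fun x y hd h => (congrArg key (eq_of_dep _ x y rfl hd h)).le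
    | succ m ih =>
      intro x y hd h
      have hy := key_ne y (by omega)
      have h1 := dep_rot y hy
      have h2 := ih x (G.rot y) (by omega) (by rw [b_rot y hy, h])
      have h3 := hk.key_rot_lt y hy
      omega
  have exists_prev : ∀ m z y, dep y = dep z + (m + 1) → b z = b y →
      ∃ w, key w ≠ 0 ∧ G.rot w = z := by
    intro m
    induction m with
    | zero =>
      intro z y hd h
      have hy := key_ne y (by omega)
      have h1 := dep_rot y hy
      exact ⟨y, hy, eq_of_dep _ _ _ rfl (by omega) (by rw [b_rot y hy, h])⟩
    | succ m ih =>
      intro z y hd h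
      have hy := key_ne y (by omega)
      have h1 := dep_rot y hy
      exact ih z (G.rot y) (by omega) (by rw [b_rot y hy, h])
  -- The successor of a dot is the deepest item over its own dot: anything less deep is preceded by
  -- a half-edge, not by a dot.
  have not_lt : ∀ d y, key d = 0 → b y = b (G.rot d) → dep y ≤ dep (G.rot d) := by
    intro d y hd h
    by_contra hlt
    obtain ⟨w, hw, hw'⟩ := exists_prev (dep y - dep (G.rot d) - 1) _ y (by omega) h.symm
    exact hw (by rwa [G.rot.injective hw'])
  have inj : ∀ x y, b x = b y → key x = key y → x = y := by
    have aux : ∀ x y, b x = b y → key x = key y → dep x ≤ dep y → x = y := by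
      intro x y h hkey hle
      rcases hle.eq_or_lt with h' | h'
      · exact eq_of_dep _ _ _ h' rfl h
      · have hy := key_ne y (by omega)
        have h1 := dep_rot y hy
        have h2 := key_le (dep y - dep x - 1) x (G.rot y) (by omega) (by rw [b_rot y hy, h])
        have h3 := hk.key_rot_lt y hy
        omega
    intro x y h hkey
    rcases le_total (dep x) (dep y) with hle | hle
    · exact aux _ _ h hkey hle
    · exact (aux _ _ h.symm hkey.symm hle).symm
  have hdot : ∀ x, G.IsDot (b x) := fun x => (hk.eq_zero_iff _).1 (key_b x)
  obtain ⟨base, hbase⟩ : ∃ base : X → S, ∀ x, (ι (base x) : X) = b x :=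
    ⟨fun x => ι.symm ⟨b x, hdot x⟩, fun x => by simp⟩
  have base_iff : ∀ x y, base x = base y ↔ b x = b y := fun x y => by
    rw [← hbase x, ← hbase y, Subtype.coe_injective.eq_iff, ι.injective.eq_iff]
  have key_ι : ∀ d, key (ι d) = 0 := fun d => (hk.eq_zero_iff _).2 (ι d).2
  have base_ι : ∀ d, base (ι d) = d := fun d => by
    apply ι.injective
    apply Subtype.ext
    rw [hbase, b_zero _ (key_ι d)]
  -- Two dots with the same image are both followed by the deepest item over it, hence coincide.
  have hinf : Function.Injective fun d => base (G.rot (ι d)) := by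
    intro d d' h
    have h' := (base_iff _ _).1 h
    have h1 := not_lt _ _ (key_ι d) h'.symm
    have h2 := not_lt _ _ (key_ι d') h'
    have := eq_of_dep _ _ _ (le_antisymm h2 h1) rfl h'
    exact ι.injective (Subtype.ext (G.rot.injective this))
  -- `h a` is one half of the edge labelled `a + 1`; the `a`-th transposition will exchange the
  -- sheets of its two halves.
  choose h hh using hk.exists_key
  have hne : ∀ x, key x ≠ 0 → base (G.opp x) ≠ base x := fun x hx h' => by
    have := inj _ _ ((base_iff _ _).1 h') (hk.key_opp x)
    exact hx ((hk.eq_zero_iff x).2 this)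
  have htau : ∀ x, key x ≠ 0 →
      tau (fun a => swap (base (h a)) (base (G.opp (h a)))) (key x) (base x) =
        base (G.opp x) := by
    intro x hx
    obtain ⟨a, ha⟩ : ∃ a : Fin s, key x = a + 1 :=
      ⟨⟨key x - 1, by have := hk.le x; omega⟩, by simp; omega⟩
    rw [ha, tau_succ]
    rcases hk.eq_or_eq_opp (h a) x (by rw [hh]; omega) (by rw [hh, ha]) with h' | h'
    · rw [h', swap_apply_left]
    · rw [h', swap_apply_right, G.opp_opp]
  refine ⟨fun a => swap (base (h a)) (base (G.opp (h a))),
    Equiv.ofBijective _ (Finite.injective_iff_bijective.1 hinf), base,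
    fun a => ⟨_, _, (hne (h a) (by rw [hh]; omega)).symm, rfl⟩, ?_⟩
  exact
    { inj := fun x y h1 => inj x y ((base_iff _ _).1 h1)
      exists_item := by
        intro c k hc
        obtain ⟨a, rfl⟩ := exists_eq_succ_of_tau_ne hc
        rw [tau_succ] at hc
        by_cases h1 : c = base (h a)
        · exact ⟨h a, h1.symm, hh a⟩
        by_cases h2 : c = base (G.opp (h a))
        · exact ⟨G.opp (h a), h2.symm, by rw [hk.key_opp, hh]⟩
        · exact absurd (swap_apply_of_ne_of_ne h1 h2) hc
      tau_ne := fun x hx => by rw [htau x hx]; exact hne x hx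
      base_dot := base_ι
      key_dot := key_ι
      base_opp := fun x => by
        by_cases hx : key x = 0
        · rw [hx, show G.opp x = x from (hk.eq_zero_iff x).1 hx]; rfl
        · exact (htau x hx).symm
      key_opp := hk.key_opp
      base_rot := fun x hx => (base_iff _ _).2 (b_rot x hx)
      key_rot_lt := hk.key_rot_lt
      base_rot_dot := fun x hx => by
        simp only [Equiv.ofBijective_apply, hbase]
        rw [b_zero x hx]
      le_key_rot := fun x y hx h1 h2 => by
        rw [base_iff] at h1
        have h3 := dep_rot x hx
        by_cases hle : dep x ≤ dep y
        · have := key_le (dep y - dep x) x y (by omega) h1.symm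
          omega
        · exact key_le (dep (G.rot x) - dep y) _ _ (by omega) (by rw [b_rot x hx, h1])
      le_key_rot_dot := fun x y hx h1 => by
        simp only [Equiv.ofBijective_apply] at h1
        rw [base_iff, hbase, b_zero x hx] at h1
        have := not_lt _ _ hx h1
        exact key_le (dep (G.rot x) - dep y) _ _ (by omega) h1 }

/-- The product of the first `k` local monodromies. -/
def tauProd {S : Type} {s : ℕ} (simple : Fin s → Perm S) : ℕ → Perm S
  | 0 => 1
  | k + 1 => tauProd simple k * tau simple (k + 1)

theorem tauProd_eq_prod_ofFn {S : Type} {s : ℕ} (simple : Fin s → Perm S) :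
    tauProd simple s = (List.ofFn simple).prod := by
  have h : ∀ k ≤ s, tauProd simple k = ((List.ofFn simple).take k).prod := by
    intro k
    induction k with
    | zero => intro _; simp [tauProd]
    | succ k ih =>
      intro hk
      have hk' : k < (List.ofFn simple).length := by simpa using hk
      rw [tauProd, ih (by omega), List.prod_take_succ _ _ hk']
      congr 1
      simp [tau, show k < s by omega]
  rw [h s le_rfl, List.take_of_length_le (by simp)]

/-- In `tauProd simple m` the factor of the largest index acts first, so factors that fix `b` can be
dropped from that end. -/
theorem tauProd_apply_eq {S : Type} {s : ℕ} {simple : Fin s → Perm S} {b : S} {k m : ℕ}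
    (hkm : k ≤ m) (h : ∀ j, k < j → j ≤ m → tau simple j b = b) :
    tauProd simple m b = tauProd simple k b := by
  induction m, hkm using Nat.le_induction with
  | base => rfl
  | succ m hm ih =>
    rw [tauProd, Perm.mul_apply, h (m + 1) (by omega) le_rfl, ih fun j h1 h2 => h j h1 (by omega)]

/-! ### Vertices, faces, dots and connectedness in terms of monodromy -/

namespace Compat

variable {X S : Type} {s : ℕ} {rot opp : Perm X} {key : X → ℕ} {ι : S → X}
  {simple : Fin s → Perm S} {infty : Perm S} {base : X → S}

theorem key_le (c : Compat rot opp key ι simple infty base) (x : X) : key x ≤ s := by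
  by_contra h
  exact c.tau_ne x (by omega) (by rw [tau_of_lt (by omega)]; rfl)

theorem opp_eq_iff (c : Compat rot opp key ι simple infty base) (x : X) :
    opp x = x ↔ key x = 0 := by
  constructor
  · intro h
    by_contra hx
    exact c.tau_ne x hx (by rw [← c.base_opp, h])
  · intro h
    exact c.inj _ _ (by rw [c.base_opp, h]; rfl) (c.key_opp x)

theorem dot_base (c : Compat rot opp key ι simple infty base) {x : X} (hx : key x = 0) :
    ι (base x) = x :=
  c.inj _ _ (c.base_dot _) (by rw [c.key_dot, hx])

theorem opp_opp [DecidableEq S] (c : Compat rot opp key ι simple infty base)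
    (hs : ∀ a, (simple a).IsSwap) (x : X) : opp (opp x) = x :=
  c.inj _ _ (by rw [c.base_opp, c.base_opp, c.key_opp, tau_tau hs]) (by rw [c.key_opp, c.key_opp])

theorem isKey [DecidableEq S] {n : ℕ} {G : DottedGraph n X}
    (c : Compat G.rot G.opp key ι simple infty base) (hs : ∀ a, (simple a).IsSwap) :
    IsKey G s key where
  eq_zero_iff x := (c.opp_eq_iff x).symm
  key_opp := c.key_opp
  le := c.key_le
  exists_key a := by
    obtain ⟨b, b', hne, h⟩ := hs a
    obtain ⟨x, -, hx⟩ := c.exists_item b (a + 1) (by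
      rw [tau_succ, h, swap_apply_left]; exact hne.symm)
    exact ⟨x, hx⟩
  eq_or_eq_opp x y hx hxy := by
    have hy := c.tau_ne y (by omega)
    rw [← hxy] at hy
    rcases eq_or_eq_tau hs (c.tau_ne x hx) hy with h | h
    · exact Or.inl (c.inj _ _ h hxy.symm)
    · exact Or.inr (c.inj _ _ (by rw [h, c.base_opp]) (by rw [c.key_opp, hxy]))
  key_rot_lt := c.key_rot_lt

/-- Going clockwise, `base` is constant until a dot is reached and then changes by `infty⁻¹`. The
section criterion therefore applies to the inverses: vertices are the points over `∞`. -/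
theorem sameCycle_rot_iff [Finite X] [Finite S] (c : Compat rot opp key ι simple infty base)
    (x y : X) : rot.SameCycle x y ↔ infty.SameCycle (base x) (base y) := by
  rw [← Perm.sameCycle_inv, ← Perm.sameCycle_inv (f := infty)]
  refine sameCycle_iff_of_section (P := fun x => key x = 0) (ι := ι) (fun x hx => c.dot_base hx)
    c.base_dot (fun x hx => ?_) (fun x hx => ?_) (fun x => ?_) x y
  · rw [← c.base_rot _ hx]; simp
  · rw [Perm.eq_inv_iff_eq, ← c.base_rot_dot _ hx]; simp
  · by_contra! h
    -- If no dot were met, the label would rise at every clockwise step and eventually exceed `s`.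
    have : ∀ k, k ≤ key ((rot⁻¹ ^ k) x) := by
      intro k
      induction k with
      | zero => omega
      | succ k ih =>
        have h1 := c.key_rot_lt _ (h (k + 1))
        rw [pow_succ', Perm.mul_apply] at h1 ⊢
        rw [show ∀ y, rot (rot⁻¹ y) = y by simp] at h1
        omega
    have h1 := this (s + 1)
    have h2 := c.key_le ((rot⁻¹ ^ (s + 1)) x)
    omega

/-- A face step crosses the edge, which keeps the label, and then turns clockwise, which raises it
unless a dot is reached. -/
theorem key_lt_key_face (c : Compat rot opp key ι simple infty base) {x : X}
    (h : key ((rot⁻¹ * opp) x) ≠ 0) : key x < key ((rot⁻¹ * opp) x) := by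
  have := c.key_rot_lt _ h
  rw [Perm.mul_apply] at this ⊢
  simpa [c.key_opp] using this

theorem add_le_key_face_pow (c : Compat rot opp key ι simple infty base) (x : X) (k : ℕ)
    (h : ∀ j, 0 < j → j ≤ k → key (((rot⁻¹ * opp) ^ j) x) ≠ 0) :
    key x + k ≤ key (((rot⁻¹ * opp) ^ k) x) := by
  induction k with
  | zero => simp
  | succ k ih =>
    have h1 := ih fun j h1 h2 => h j h1 (by omega)
    have h2 := h (k + 1) (by omega) le_rfl
    rw [pow_succ', Perm.mul_apply] at h2 ⊢
    have := c.key_lt_key_face h2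
    omega

theorem exists_key_face_pow_eq_zero (c : Compat rot opp key ι simple infty base) (x : X) :
    ∃ k, key (((rot⁻¹ * opp) ^ k) x) = 0 := by
  by_contra! h
  have h1 := c.add_le_key_face_pow x (s + 1) fun j _ _ => h j
  have h2 := c.key_le (((rot⁻¹ * opp) ^ (s + 1)) x)
  omega

/-- Without a dot in between labels would increase strictly from `x` to `opp x`, but the two halves
of an edge carry the same label. -/
theorem exists_between (c : Compat rot opp key ι simple infty base) {x : X} {k : ℕ}
    (hx : key x ≠ 0) (hk : ((rot⁻¹ * opp) ^ k) x = opp x) :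
    ∃ j < k, key (((rot⁻¹ * opp) ^ j) x) = 0 := by
  by_contra! h
  have h1 := c.add_le_key_face_pow x k fun j _ hj => by
    rcases hj.eq_or_lt with rfl | hj
    · rwa [hk, c.key_opp]
    · exact h j hj
  rw [hk, c.key_opp] at h1
  obtain rfl : k = 0 := by omega
  exact hx ((c.opp_eq_iff x).1 hk.symm)

/-- The sheet, at the centre of the face to which it belongs, in which an item lies. -/
def sheet (_ : Compat rot opp key ι simple infty base) (x : X) : S :=
  -- For a dot the subtraction truncates to `0`, the product is trivial and the sheet is `base x`.
  tauProd simple (key x - 1) (base x)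

theorem sheet_dot (c : Compat rot opp key ι simple infty base) (d : S) : c.sheet (ι d) = d := by
  simp [sheet, c.key_dot, c.base_dot, tauProd]

/-- The extra factor with index `key x` cancels the passage from `base x` to `base (opp x)`. -/
theorem tauProd_base_opp [DecidableEq S] (c : Compat rot opp key ι simple infty base)
    (hs : ∀ a, (simple a).IsSwap) (x : X) :
    tauProd simple (key x) (base (opp x)) = c.sheet x := by
  rw [c.base_opp, sheet]
  cases key x with
  | zero => rfl
  | succ k => rw [tauProd, Perm.mul_apply, tau_tau hs]; rfl

/-- The next item carries the first label above `key x` whose transposition moves `base (opp x)`;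
the labels skipped fix this sheet and leave the product unchanged. -/
theorem sheet_face_of_ne [DecidableEq S] (c : Compat rot opp key ι simple infty base)
    (hs : ∀ a, (simple a).IsSwap) {x : X} (h : key ((rot⁻¹ * opp) x) ≠ 0) :
    c.sheet ((rot⁻¹ * opp) x) = c.sheet x := by
  have hrot : rot ((rot⁻¹ * opp) x) = opp x := by simp
  have hlt := c.key_lt_key_face h
  have hb := c.base_rot _ h
  rw [hrot] at hb
  rw [← c.tauProd_base_opp hs x, hb]
  refine tauProd_apply_eq (by omega) fun j h1 h2 => ?_
  by_contra hj
  obtain ⟨z, hz1, hz2⟩ := c.exists_item _ _ hj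
  have := c.le_key_rot _ z h hz1 (by omega)
  rw [hrot, c.key_opp] at this
  omega

/-- When a dot comes next, no label above `key x` moves `base (opp x)`, so the full product acts
there as the partial one. That sheet is `infty` of the new dot, and the relation between the
monodromies yields `zero`. -/
theorem sheet_face_of_eq [DecidableEq S] (c : Compat rot opp key ι simple infty base)
    (hs : ∀ a, (simple a).IsSwap) {zero : Perm S}
    (hz : zero * (List.ofFn simple).prod * infty = 1) {x : X} (h : key ((rot⁻¹ * opp) x) = 0) :
    c.sheet ((rot⁻¹ * opp) x) = zero (c.sheet x) := by
  have hrot : rot ((rot⁻¹ * opp) x) = opp x := by simp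
  have hb := c.base_rot_dot _ h
  rw [hrot] at hb
  have h1 : tauProd simple s (base (opp x)) = c.sheet x := by
    rw [← c.tauProd_base_opp hs x]
    refine tauProd_apply_eq (c.key_le x) fun j h1 h2 => ?_
    by_contra hj
    obtain ⟨z, hz1, hz2⟩ := c.exists_item _ _ hj
    have := c.le_key_rot_dot _ z h (by rw [hz1, hb])
    rw [hrot, c.key_opp] at this
    omega
  have h2 : c.sheet ((rot⁻¹ * opp) x) = base ((rot⁻¹ * opp) x) := by
    rw [sheet, h]; rfl
  rw [h2, ← h1, hb, tauProd_eq_prod_ofFn, ← Perm.mul_apply, ← Perm.mul_apply, hz]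
  rfl

theorem sameCycle_face_iff [Finite X] [Finite S] [DecidableEq S]
    (c : Compat rot opp key ι simple infty base)
    (hs : ∀ a, (simple a).IsSwap) {zero : Perm S}
    (hz : zero * (List.ofFn simple).prod * infty = 1) (x y : X) :
    (rot⁻¹ * opp).SameCycle x y ↔ zero.SameCycle (c.sheet x) (c.sheet y) := by
  refine sameCycle_iff_of_section (P := fun x => key x = 0) (ι := ι) (fun x hx => ?_)
    c.sheet_dot (fun x hx => c.sheet_face_of_ne hs hx) (fun x hx => c.sheet_face_of_eq hs hz hx)
    c.exists_key_face_pow_eq_zero x y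
  have : c.sheet x = base x := by rw [sheet, hx]; rfl
  rw [this, c.dot_base hx]

/-- The faces are the points over `0`. -/
theorem card_cycles_face [Finite X] [Finite S] [DecidableEq S]
    (c : Compat rot opp key ι simple infty base)
    (hs : ∀ a, (simple a).IsSwap) {zero : Perm S}
    (hz : zero * (List.ofFn simple).prod * infty = 1) :
    Nat.card (Cycles (rot⁻¹ * opp)) = Nat.card (Cycles zero) := by
  refine Nat.card_congr (Equiv.ofBijective (Quotient.map c.sheet
    fun x y h => (c.sameCycle_face_iff hs hz x y).1 h) ⟨?_, ?_⟩)
  · intro p q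
    induction p, q using Quotient.inductionOn₂ with
    | h x y =>
      intro h
      exact Quotient.sound ((c.sameCycle_face_iff hs hz x y).2 (Quotient.exact h))
  · intro q
    induction q using Quotient.inductionOn with
    | h d => exact ⟨Quotient.mk _ (ι d), by simp [c.sheet_dot]⟩

/-- The dots are the sheets. -/
theorem card_dots_eq (c : Compat rot opp key ι simple infty base) {p : X → Prop} {q : S → Prop}
    (h : ∀ d, p (ι d) ↔ q d) : Nat.card {y // opp y = y ∧ p y} = Nat.card {d // q d} := by
  symm
  refine Nat.card_congr (Equiv.ofBijective
    (fun d => ⟨ι d.1, (c.opp_eq_iff _).2 (c.key_dot _), (h _).2 d.2⟩) ⟨?_, ?_⟩)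
  · rintro ⟨d, hd⟩ ⟨d', hd'⟩ h'
    have := congrArg base (congrArg Subtype.val h')
    simpa [c.base_dot] using this
  · rintro ⟨y, hy, hp⟩
    have hy' := c.dot_base ((c.opp_eq_iff y).1 hy)
    exact ⟨⟨base y, by rwa [← h, hy']⟩, Subtype.ext hy'⟩

/-- Invariant predicates on sheets pull back along `base`, and those on items restrict along `ι` to
the dots. -/
theorem transitive_iff [Finite X] [Finite S]
    (c : Compat rot opp key ι simple infty base) {zero : Perm S}
    (hz : zero * (List.ofFn simple).prod * infty = 1) :
    (∀ x y, ∃ w ∈ Subgroup.closure ({rot, opp} : Set (Perm X)), w x = y) ↔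
      ∀ x y, ∃ w ∈ Subgroup.closure ({zero, infty} ∪ Set.range simple), w x = y := by
  rw [transitive_iff_invariant, transitive_iff_invariant]
  constructor
  · intro h P hP d d' hd
    have hinf : ∀ d, P (infty d) ↔ P d := hP infty (by simp)
    have htau : ∀ k d, P (tau simple k d) ↔ P d := by
      intro k d
      by_cases hk : tau simple k d = d
      · rw [hk]
      · obtain ⟨a, rfl⟩ := exists_eq_succ_of_tau_ne hk
        rw [tau_succ]
        exact hP _ (by simp) d
    have := h (fun x => P (base x)) ?_ (ι d) (ι d')
    · simp only [c.base_dot] at this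
      exact this hd
    · intro t ht x
      rcases ht with rfl | rfl
      · by_cases hx : key x = 0
        · rw [c.base_rot_dot x hx, hinf]
        · rw [c.base_rot x hx]
      · rw [c.base_opp, htau]
  · intro h P hP
    have hrot : ∀ x, P (rot x) ↔ P x := hP rot (by simp)
    have hopp : ∀ x, P (opp x) ↔ P x := hP opp (by simp)
    have hcyc : ∀ {x y}, rot.SameCycle x y → (P x ↔ P y) := by
      intro x y hxy
      obtain ⟨i, rfl⟩ := hxy.exists_nat_pow_eq
      clear hxy
      induction i with
      | zero => rfl
      | succ i ih => rw [pow_succ', Perm.mul_apply, hrot, ih]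
    have hbase : ∀ x, P (ι (base x)) ↔ P x := fun x =>
      hcyc ((c.sameCycle_rot_iff _ _).2 (by rw [c.base_dot]))
    have hinf : ∀ d, P (ι (infty d)) ↔ P (ι d) := fun d =>
      hcyc ((c.sameCycle_rot_iff _ _).2 (by
        rw [c.base_dot, c.base_dot]
        exact Perm.sameCycle_apply_left.2 (Perm.SameCycle.refl _ _)))
    have htau : ∀ k d, P (ι (tau simple k d)) ↔ P (ι d) := by
      intro k d
      by_cases hk : tau simple k d = d
      · rw [hk]
      · obtain ⟨x, rfl, rfl⟩ := c.exists_item d k hk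
        rw [← c.base_opp, hbase, hbase, hopp]
    have hprod : ∀ k d, P (ι (tauProd simple k d)) ↔ P (ι d) := by
      intro k
      induction k with
      | zero => intro d; rfl
      | succ k ih => intro d; rw [tauProd, Perm.mul_apply, ih, htau]
    -- `zero` is not visible in the rotation system, but the product relation expresses it through
    -- the other monodromies.
    have hzero : ∀ d, P (ι (zero d)) ↔ P (ι d) := by
      intro d
      have h1 : d = (List.ofFn simple).prod (infty (infty⁻¹ ((List.ofFn simple).prod⁻¹ d))) := by
        simp
      have h2 : zero d = infty⁻¹ ((List.ofFn simple).prod⁻¹ d) := by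
        conv_lhs => rw [h1, ← Perm.mul_apply, ← Perm.mul_apply, hz]
        rfl
      conv_rhs => rw [h1, ← tauProd_eq_prod_ofFn, hprod, hinf]
      rw [h2, tauProd_eq_prod_ofFn]
    intro x y hx
    rw [← hbase]
    refine h (fun d => P (ι d)) ?_ (base x) (base y) ((hbase x).2 hx)
    intro t ht d
    rcases ht with (rfl | rfl) | ⟨a, rfl⟩
    · exact hzero d
    · exact hinf d
    · rw [← tau_succ (simple := simple)]; exact htau _ _

/-- On the perimeter of a face, dots lie on both sides between the two halves of an edge. -/
theorem dots_between [Finite X] [DecidableEq S] (c : Compat rot opp key ι simple infty base)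
    (hs : ∀ a, (simple a).IsSwap) {x : X} {k r : ℕ}
    (hr : Nat.card {y // opp y = y ∧ (rot⁻¹ * opp).SameCycle x y} = r) (hx : ¬ opp x = x)
    (hk : ((rot⁻¹ * opp) ^ k) x = opp x) (hmin : ∀ j < k, ((rot⁻¹ * opp) ^ j) x ≠ opp x) :
    0 < Nat.card {j : ℕ // j < k ∧ opp (((rot⁻¹ * opp) ^ j) x) = ((rot⁻¹ * opp) ^ j) x} ∧
      Nat.card {j : ℕ // j < k ∧ opp (((rot⁻¹ * opp) ^ j) x) = ((rot⁻¹ * opp) ^ j) x} < r := by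
  classical
  set f := rot⁻¹ * opp with hf
  have hfin : Finite {j : ℕ // j < k ∧ opp ((f ^ j) x) = (f ^ j) x} :=
    Set.Finite.subset (Set.finite_lt_nat k) fun j hj => hj.1
  rw [c.opp_eq_iff] at hx
  constructor
  · obtain ⟨j, hj, hj'⟩ := c.exists_between hx hk
    have : Nonempty {j : ℕ // j < k ∧ opp ((f ^ j) x) = (f ^ j) x} :=
      ⟨j, hj, (c.opp_eq_iff _).2 hj'⟩
    exact Nat.card_pos
  -- A repetition would give a shorter way from `x` to `opp x`.
  · have hinj : ∀ i j, i < j → j ≤ k → (f ^ i) x ≠ (f ^ j) x := by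
      intro i j hij hjk h
      have h1 : (f ^ (k - j + i)) x = opp x := by
        rw [pow_add, Perm.mul_apply, h, ← Perm.mul_apply, ← pow_add, ← hk]
        congr 2
        omega
      exact hmin _ (by omega) h1
    have hcyc : f.SameCycle (opp x) x := by
      rw [← hk]
      exact (Perm.SameCycle.symm ⟨k, by simp⟩)
    have hex : ∃ m, (f ^ m) (opp x) = x := hcyc.exists_nat_pow_eq
    obtain ⟨m, hm, hmmin⟩ : ∃ m, (f ^ m) (opp x) = x ∧ ∀ j < m, (f ^ j) (opp x) ≠ x :=
      ⟨Nat.find hex, Nat.find_spec hex, fun j hj => Nat.find_min hex hj⟩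
    -- The way back from `opp x` to `x` also contains a dot. By minimality of `k` and `m` it is off
    -- the way out, so the way out misses one of the `r` dots of the face.
    obtain ⟨l, hl, hl'⟩ := c.exists_between (x := opp x) (k := m) (by rwa [c.key_opp])
      (by rw [c.opp_opp hs, ← hf, hm])
    have hne : ∀ j < k, (f ^ j) x ≠ (f ^ l) (opp x) := by
      intro j hj h
      rcases le_total j l with hjl | hjl
      · have h1 : (f ^ j) x = (f ^ j) ((f ^ (l - j)) (opp x)) := by
          rw [h, ← Perm.mul_apply (f ^ j), ← pow_add, Nat.add_sub_cancel' hjl]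
        exact hmmin (l - j) (by omega) ((f ^ j).injective h1).symm
      · have h1 : (f ^ l) ((f ^ (j - l)) x) = (f ^ l) (opp x) := by
          rw [← h, ← Perm.mul_apply (f ^ l), ← pow_add, Nat.add_sub_cancel' hjl]
        exact hmin (j - l) (by omega) ((f ^ l).injective h1)
    rw [← hr, Nat.lt_iff_add_one_le, ← Finite.card_option]
    refine (Nat.card_le_card_of_injective
      (fun o : Option {j : ℕ // j < k ∧ opp ((f ^ j) x) = (f ^ j) x} =>
        (o.elim ⟨(f ^ l) (opp x), (c.opp_eq_iff _).2 hl',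
          hcyc.symm.trans ⟨l, by simp⟩⟩ fun j => ⟨(f ^ j.1) x, j.2.2, ⟨j.1, by simp⟩⟩ :
          {y // opp y = y ∧ f.SameCycle x y})) ?_)
    rintro (_ | ⟨i, hi, hi'⟩) (_ | ⟨j, hj, hj'⟩) h
    · rfl
    · exact absurd (congrArg Subtype.val h).symm (hne j hj)
    · exact absurd (congrArg Subtype.val h) (hne i hi)
    · have h1 : (f ^ i) x = (f ^ j) x := congrArg Subtype.val h
      rcases lt_trichotomy i j with hij | rfl | hij
      · exact absurd h1 (hinj i j hij hj.le)
      · rfl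
      · exact absurd h1.symm (hinj j i hij hi.le)

/-- The monodromy determines the rotation system. -/
theorem rotation_eq {rot' opp' : Perm X} {ι' : S → X}
    (c : Compat rot opp key ι simple infty base)
    (c' : Compat rot' opp' key ι' simple infty base) : rot = rot' ∧ opp = opp' ∧ ι = ι' := by
  refine ⟨Equiv.ext fun x => ?_, Equiv.ext fun x => ?_, funext fun d => ?_⟩
  · by_cases hx : key x = 0
    · exact c.inj _ _ (by rw [c.base_rot_dot x hx, c'.base_rot_dot x hx])
        (le_antisymm (c'.le_key_rot_dot x _ hx (c.base_rot_dot x hx))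
          (c.le_key_rot_dot x _ hx (c'.base_rot_dot x hx)))
    · exact c.inj _ _ (by rw [c.base_rot x hx, c'.base_rot x hx])
        (le_antisymm (c'.le_key_rot x _ hx (c.base_rot x hx) (c.key_rot_lt x hx))
          (c.le_key_rot x _ hx (c'.base_rot x hx) (c'.key_rot_lt x hx)))
  · exact c.inj _ _ (by rw [c.base_opp, c'.base_opp]) (by rw [c.key_opp, c'.key_opp])
  · exact c.inj _ _ (by rw [c.base_dot, c'.base_dot]) (by rw [c.key_dot, c'.key_dot])

/-- The rotation system determines the monodromy. -/
theorem monodromy_eq {simple' : Fin s → Perm S} {infty' : Perm S} {base' : X → S}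
    (c : Compat rot opp key ι simple infty base)
    (c' : Compat rot opp key ι simple' infty' base') :
    base = base' ∧ simple = simple' ∧ infty = infty' := by
  -- Induction on the label: descending along `rot` changes neither base until a dot is reached,
  -- where `ι` determines both.
  have hb : ∀ m x, key x ≤ m → base x = base' x := by
    intro m
    induction m with
    | zero =>
      intro x hx
      rw [← c.dot_base (x := x) (by omega), c.base_dot, c'.base_dot]
    | succ m ih =>
      intro x hx
      by_cases h : key x = 0
      · exact ih x (by omega)
      · rw [← c.base_rot x h, ← c'.base_rot x h]
        exact ih _ (by have := c.key_rot_lt x h; omega)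
  obtain rfl : base = base' := funext fun x => hb _ x le_rfl
  refine ⟨rfl, funext fun a => Equiv.ext fun b => ?_, Equiv.ext fun d => ?_⟩
  · rw [← tau_succ (simple := simple), ← tau_succ (simple := simple')]
    by_cases h : ∃ x, base x = b ∧ key x = a + 1
    · obtain ⟨x, rfl, hx⟩ := h
      rw [← hx, ← c.base_opp, c'.base_opp]
    · have h1 : tau simple (a + 1) b = b := by
        by_contra h1
        exact h (c.exists_item _ _ h1)
      have h2 : tau simple' (a + 1) b = b := by
        by_contra h2
        exact h (c'.exists_item _ _ h2)
      rw [h1, h2]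
  · have h1 := c.base_rot_dot (ι d) (c.key_dot d)
    rw [c'.base_rot_dot (ι d) (c.key_dot d), c.base_dot] at h1
    exact h1.symm

end Compat

/-! ### Edge labellings -/

section EdgeLabeling

variable {n s : ℕ} {X : Type}

theorem DottedGraph.edgeOf_eq_iff (G : DottedGraph n X) {x y : X} (hx : ¬ G.IsDot x)
    (hy : ¬ G.IsDot y) : G.edgeOf x hx = G.edgeOf y hy ↔ x = y ∨ x = G.opp y := by
  refine Subtype.ext_iff.trans ?_
  change s(x, G.opp x) = s(y, G.opp y) ↔ _
  rw [Sym2.eq_iff]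
  constructor
  · rintro (⟨h, -⟩ | ⟨h, -⟩)
    · exact Or.inl h
    · exact Or.inr h
  · rintro (rfl | rfl)
    · exact Or.inl ⟨rfl, rfl⟩
    · exact Or.inr ⟨rfl, G.opp_opp _⟩

theorem DottedGraph.exists_edgeOf (G : DottedGraph n X) (e : G.Edge) :
    ∃ x, ∃ hx : ¬ G.IsDot x, e = G.edgeOf x hx := by
  obtain ⟨e, x, hx, rfl⟩ := e
  exact ⟨x, hx, rfl⟩

theorem DottedGraph.isDot_opp_iff (G : DottedGraph n X) (x : X) :
    G.IsDot (G.opp x) ↔ G.IsDot x := by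
  simp [DottedGraph.IsDot]

theorem IsKey.exists_equiv {G : DottedGraph n X} {key : X → ℕ} (hk : IsKey G s key) :
    ∃ l : G.Edge ≃ Fin s, ∀ x hx, (l (G.edgeOf x hx) : ℕ) + 1 = key x := by
  choose u hu hu' using G.exists_edgeOf
  have hpos : ∀ x, ¬ G.IsDot x → key x ≠ 0 := fun x hx h => hx ((hk.eq_zero_iff x).1 h)
  have hkey : ∀ x hx, key (u (G.edgeOf x hx)) = key x := fun x hx => by
    rcases (G.edgeOf_eq_iff hx (hu _)).1 (hu' (G.edgeOf x hx)) with h | h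
    · rw [← h]
    · rw [← hk.key_opp, ← h]
  have hlt : ∀ e, key (u e) - 1 < s := fun e => by
    have h1 := hpos _ (hu e)
    have h2 := hk.le (u e)
    omega
  obtain ⟨f, hf⟩ : ∃ f : G.Edge → Fin s, ∀ e, (f e : ℕ) = key (u e) - 1 :=
    ⟨fun e => ⟨_, hlt e⟩, fun _ => rfl⟩
  have hf' : ∀ x hx, (f (G.edgeOf x hx) : ℕ) + 1 = key x := fun x hx => by
    have := hpos x hx
    rw [hf, hkey]
    omega
  refine ⟨Equiv.ofBijective f ⟨fun e e' h => ?_, fun a => ?_⟩, hf'⟩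
  · have h1 := hpos _ (hu e)
    have h2 := hpos _ (hu e')
    have h3 := hf e
    have h4 := hf e'
    rw [h] at h3
    rw [hu' e, hu' e', G.edgeOf_eq_iff]
    exact hk.eq_or_eq_opp _ _ h2 (by omega)
  · obtain ⟨x, hx⟩ := hk.exists_key a
    have hx' : ¬ G.IsDot x := fun h => by
      rw [(hk.eq_zero_iff x).2 h] at hx
      omega
    have := hf' x hx'
    exact ⟨G.edgeOf x hx', Fin.ext (by omega)⟩

/-- Labels are shifted by one so that `0` marks the dots. Since `rot (face x) = opp x`, increase
along a face is the same condition as decrease along `rot`; next to a dot the latter holds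
automatically. -/
theorem card_edgeLabeling {r g : ℕ} {μ : Fin n → ℕ} (G : ArrowedGraph r g μ X) (s : ℕ) :
    Nat.card (G.EdgeLabeling s) = Nat.card {key : X → ℕ // IsKey G.toDottedGraph s key} := by
  classical
  have hopp : ∀ x hx hx', G.edgeOf (G.opp x) hx = G.edgeOf x hx' := fun x hx hx' =>
    (G.edgeOf_eq_iff _ _).2 (Or.inr rfl)
  have hkey : ∀ l : G.EdgeLabeling s, IsKey G.toDottedGraph s
      (fun x => if hx : G.IsDot x then 0 else (l.1 (G.edgeOf x hx) : ℕ) + 1) := by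
    rintro ⟨l, hl⟩
    refine ⟨fun x => ?_, fun x => ?_, fun x => ?_, fun a => ?_, fun x y hx hxy => ?_,
      fun x hx => ?_⟩
    · by_cases hx : G.IsDot x <;> simp [hx]
    · by_cases hx : G.IsDot x
      · have hx' := (G.isDot_opp_iff x).2 hx
        simp [hx, hx']
      · have hx' := mt (G.isDot_opp_iff x).1 hx
        simp [hx, hx', hopp]
    · by_cases hx : G.IsDot x
      · simp [hx]
      · simp only [hx, dite_false]
        have := (l (G.edgeOf x hx)).2
        omega
    · obtain ⟨x, hx, hx'⟩ := G.exists_edgeOf (l.symm a)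
      exact ⟨x, by simp [hx, ← hx']⟩
    · have hdx : ¬ G.IsDot x := fun h => hx (by simp [h])
      have hdy : ¬ G.IsDot y := fun h => hx (by rw [hxy]; simp [h])
      simp only [hdx, hdy, dite_false, Nat.add_right_cancel_iff] at hxy
      exact (G.edgeOf_eq_iff hdy hdx).1 (l.injective (Fin.ext hxy)).symm
    · have hdx : ¬ G.IsDot x := fun h => hx (by simp [h])
      by_cases hr : G.IsDot (G.rot x)
      · simp [hdx, hr]
      -- The edge of `rot x` is the one that precedes `x` on the perimeter of a face.
      · have hf : G.face (G.opp (G.rot x)) = x := by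
          simp [DottedGraph.face, G.opp_opp]
        have h := hl (G.opp (G.rot x)) (mt (G.isDot_opp_iff _).1 hr) (by rwa [hf])
        simp only [hf, hopp _ _ hr] at h
        simpa [hdx, hr] using h
  refine Nat.card_congr (Equiv.ofBijective (fun l => ⟨_, hkey l⟩) ⟨?_, ?_⟩)
  · intro l l' h
    refine Subtype.ext (Equiv.ext fun e => ?_)
    obtain ⟨x, hx, rfl⟩ := G.exists_edgeOf e
    have := congrFun (congrArg Subtype.val h) x
    simp only [hx, dite_false, Nat.add_right_cancel_iff] at this
    exact Fin.ext this
  · rintro ⟨key, hk⟩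
    obtain ⟨l, hl⟩ := hk.exists_equiv
    refine ⟨⟨l, fun x hx hy => ?_⟩, Subtype.ext (funext fun x => ?_)⟩
    · have h1 := hk.key_rot_lt (G.face x) fun h => hy ((hk.eq_zero_iff _).1 h)
      have hf : G.rot (G.face x) = G.opp x := by simp [DottedGraph.face]
      rw [hf, hk.key_opp, ← hl x hx, ← hl _ hy] at h1
      exact Fin.lt_def.2 (by omega)
    · by_cases hx : G.IsDot x
      · simp [hx, (hk.eq_zero_iff x).2 hx]
      · simp [hx, hl]

theorem IsKey.card_edge {G : DottedGraph n X} {key : X → ℕ} (hk : IsKey G s key) :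
    Nat.card G.Edge = s := by
  obtain ⟨l, -⟩ := hk.exists_equiv
  rw [Nat.card_congr l, Nat.card_fin]

end EdgeLabeling

/-! ### Transport of structure -/

namespace ArrowedGraph

variable {r g n : ℕ} {μ : Fin n → ℕ} {X : Type}

theorem ext_of {G G' : ArrowedGraph r g μ X} (h1 : G.rot = G'.rot) (h2 : G.opp = G'.opp)
    (h3 : G.vert = G'.vert) (h4 : G.arrow = G'.arrow) : G = G' := by
  obtain ⟨⟨⟨a, b, _, c, _, _, _⟩, _, _, _, _⟩, d, _, _⟩ := G
  obtain ⟨⟨⟨a', b', _, c', _, _, _⟩, _, _, _, _⟩, d', _, _⟩ := G'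
  dsimp only at h1 h2 h3 h4
  subst h1 h2 h3 h4
  rfl

theorem IsIso.unique {π : Perm X} {G G₁ G₂ : ArrowedGraph r g μ X} (h : IsIso π G G₁)
    (k : IsIso π G G₂) : G₁ = G₂ := by
  obtain ⟨h1, h2, h3, h4⟩ := h
  obtain ⟨k1, k2, k3, k4⟩ := k
  refine ext_of (Equiv.ext fun x => ?_) (Equiv.ext fun x => ?_) (funext fun x => ?_)
    (funext fun i => ?_)
  · obtain ⟨x, rfl⟩ := π.surjective x; rw [← h1, k1]
  · obtain ⟨x, rfl⟩ := π.surjective x; rw [← h2, k2]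
  · obtain ⟨x, rfl⟩ := π.surjective x; rw [← h3, k3]
  · rw [← h4, k4]

theorem IsIso.inv {π : Perm X} {G G' : ArrowedGraph r g μ X} (h : IsIso π G G') :
    IsIso π⁻¹ G' G := by
  obtain ⟨h1, h2, h3, h4⟩ := h
  refine ⟨fun x => ?_, fun x => ?_, fun x => ?_, fun i => ?_⟩
  · rw [Perm.inv_eq_iff_eq, h1]; simp
  · rw [Perm.inv_eq_iff_eq, h2]; simp
  · rw [h3]; simp
  · rw [Perm.inv_eq_iff_eq, h4]

theorem IsIso.mul {π ρ : Perm X} {G G' G'' : ArrowedGraph r g μ X} (h : IsIso π G G')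
    (k : IsIso ρ G' G'') : IsIso (ρ * π) G G'' := by
  obtain ⟨h1, h2, h3, h4⟩ := h
  obtain ⟨k1, k2, k3, k4⟩ := k
  exact ⟨fun x => by simp [h1, k1], fun x => by simp [h2, k2],
    fun x => by simp [h3, k3], fun i => by simp [h4, k4]⟩

end ArrowedGraph

theorem conj_inv_mul_conj {X : Type} (π a b : Perm X) :
    (π * a * π⁻¹)⁻¹ * (π * b * π⁻¹) = π * (a⁻¹ * b) * π⁻¹ := by
  group

theorem card_cycles_conj {X : Type} (π f : Perm X) :
    Nat.card (Cycles (π * f * π⁻¹)) = Nat.card (Cycles f) := by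
  refine (Nat.card_congr (Quotient.congr π fun x y => ?_)).symm
  change f.SameCycle x y ↔ (π * f * π⁻¹).SameCycle (π x) (π y)
  rw [Perm.sameCycle_conj]
  simp

theorem transitive_conj {X : Type} (π : Perm X) {T T' : Set (Perm X)}
    (hT : ∀ t ∈ T, π * t * π⁻¹ ∈ T')
    (h : ∀ x y, ∃ w ∈ Subgroup.closure T, w x = y) :
    ∀ x y, ∃ w ∈ Subgroup.closure T', w x = y := by
  rw [transitive_iff_invariant] at h ⊢
  intro P hP x y hx
  have := h (fun x => P (π x)) (fun t ht x => by
    have := hP _ (hT t ht) (π x)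
    simpa using this) (π⁻¹ x) (π⁻¹ y)
  simp only [show ∀ x, π (π⁻¹ x) = x by simp] at this
  exact this hx

/-- Transport of a cell graph along a permutation of the items. -/
def DottedGraph.conj {n : ℕ} {X : Type} (G : DottedGraph n X) (π : Perm X) : DottedGraph n X where
  rot := π * G.rot * π⁻¹
  opp := π * G.opp * π⁻¹
  opp_opp x := by simp [G.opp_opp]
  vert x := G.vert (π⁻¹ x)
  vert_surjective := G.vert_surjective.comp π⁻¹.surjective
  vert_eq_iff x y := by rw [G.vert_eq_iff, Perm.sameCycle_conj]
  connected := transitive_conj π (by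
    rintro t (rfl | rfl)
    · exact Or.inl rfl
    · exact Or.inr rfl) G.connected

section Conj

variable {r g n : ℕ} {μ : Fin n → ℕ} {X : Type}

theorem DottedGraph.face_conj (G : DottedGraph n X) (π : Perm X) :
    (G.conj π).face = π * G.face * π⁻¹ :=
  conj_inv_mul_conj π G.rot G.opp

theorem DottedGraph.isDot_conj (G : DottedGraph n X) (π : Perm X) (x : X) :
    (G.conj π).IsDot (π x) ↔ G.IsDot x := by
  simp [DottedGraph.IsDot, DottedGraph.conj]

theorem DottedGraph.card_edge_conj (G : DottedGraph n X) (π : Perm X) :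
    Nat.card (G.conj π).Edge = Nat.card G.Edge := by
  have hinv : ∀ σ ρ : Perm X, σ * ρ = 1 → Function.LeftInverse (Sym2.map σ) (Sym2.map ρ) := by
    intro σ ρ h e
    rw [Sym2.map_map, ← Perm.coe_mul, h]
    exact congrFun Sym2.map_id e
  let e : Sym2 X ≃ Sym2 X :=
    ⟨Sym2.map π, Sym2.map (π⁻¹ : Perm X), hinv _ _ (by simp), hinv _ _ (by simp)⟩
  have he : ∀ x y, e s(x, y) = s(π x, π y) := fun _ _ => rfl
  refine (Nat.card_congr (Equiv.subtypeEquiv e fun z => ?_)).symm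
  constructor
  · rintro ⟨x, hx, rfl⟩
    exact ⟨π x, mt (G.isDot_conj π x).1 hx, by rw [he]; simp [DottedGraph.conj]⟩
  · rintro ⟨x, hx, h⟩
    obtain ⟨x, rfl⟩ := π.surjective x
    refine ⟨x, mt (G.isDot_conj π x).2 hx, e.injective (h.trans ?_)⟩
    rw [he]
    simp [DottedGraph.conj]

/-- Transport of an arrowed graph along a permutation of the items. -/
def ArrowedGraph.conj (G : ArrowedGraph r g μ X) (π : Perm X) : ArrowedGraph r g μ X where
  toDottedGraph := G.toDottedGraph.conj π
  hasGenus := by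
    rw [DottedGraph.HasGenus, DottedGraph.card_edge_conj, DottedGraph.Face,
      DottedGraph.face_conj, card_cycles_conj]
    exact G.hasGenus
  dots_face x := by
    refine Eq.trans (Nat.card_congr (Equiv.subtypeEquiv π fun y => ?_)).symm (G.dots_face (π⁻¹ x))
    rw [G.isDot_conj, G.face_conj, Perm.sameCycle_conj]
    simp
  dots_vert i := by
    refine Eq.trans (Nat.card_congr (Equiv.subtypeEquiv π fun y => ?_)).symm (G.dots_vert i)
    rw [G.isDot_conj]
    simp [DottedGraph.conj]
  dots_between x k hx hk hmin := by
    obtain ⟨x, rfl⟩ := π.surjective x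
    have hpow : ∀ j, ((G.toDottedGraph.conj π).face ^ j) (π x) = π ((G.face ^ j) x) := by
      intro j
      rw [G.face_conj, conj_pow]
      simp
    have hopp : (G.toDottedGraph.conj π).opp (π x) = π (G.opp x) := by
      simp [DottedGraph.conj]
    rw [G.isDot_conj] at hx
    simp only [hpow, hopp, ne_eq, EmbeddingLike.apply_eq_iff_eq] at hk hmin
    simp only [hpow, G.isDot_conj]
    exact G.dots_between x k hx hk hmin
  arrow i := π (G.arrow i)
  arrow_isDot i := (G.isDot_conj π _).2 (G.arrow_isDot i)
  vert_arrow i := by simpa [DottedGraph.conj] using G.vert_arrow i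

theorem ArrowedGraph.isIso_conj (G : ArrowedGraph r g μ X) (π : Perm X) :
    IsIso π G (G.conj π) :=
  ⟨fun x => by simp [ArrowedGraph.conj, DottedGraph.conj],
    fun x => by simp [ArrowedGraph.conj, DottedGraph.conj],
    fun x => by simp [ArrowedGraph.conj, DottedGraph.conj], fun _ => rfl⟩

theorem ArrowedGraph.IsIso.card_isKey_eq {π : Perm X} {G G' : ArrowedGraph r g μ X}
    (h : IsIso π G G') (s : ℕ) :
    Nat.card {key : X → ℕ // IsKey G.toDottedGraph s key} =
      Nat.card {key : X → ℕ // IsKey G'.toDottedGraph s key} := by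
  obtain ⟨h1, h2, h3, h4⟩ := h
  refine Nat.card_congr (Equiv.subtypeEquiv (Equiv.arrowCongr π (Equiv.refl ℕ)) fun key => ?_)
  have hd : ∀ x, G'.IsDot (π x) ↔ G.IsDot x := fun x => by
    simp [DottedGraph.IsDot, ← h2]
  constructor
  · intro hk
    refine ⟨fun x => ?_, fun x => ?_, fun x => ?_, fun a => ?_, fun x y => ?_, fun x => ?_⟩
    · obtain ⟨x, rfl⟩ := π.surjective x
      simpa [hd] using hk.eq_zero_iff x
    · obtain ⟨x, rfl⟩ := π.surjective x
      simpa [← h2] using hk.key_opp x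
    · simpa using hk.le (π.symm x)
    · obtain ⟨x, hx⟩ := hk.exists_key a
      exact ⟨π x, by simpa using hx⟩
    · obtain ⟨x, rfl⟩ := π.surjective x
      obtain ⟨y, rfl⟩ := π.surjective y
      simpa [← h2] using hk.eq_or_eq_opp x y
    · obtain ⟨x, rfl⟩ := π.surjective x
      simpa [← h1] using hk.key_rot_lt x
  · intro hk
    refine ⟨fun x => ?_, fun x => ?_, fun x => ?_, fun a => ?_, fun x y => ?_, fun x => ?_⟩
    · simpa [hd] using hk.eq_zero_iff (π x)
    · simpa [← h2] using hk.key_opp (π x)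
    · simpa using hk.le (π x)
    · obtain ⟨x, hx⟩ := hk.exists_key a
      exact ⟨π.symm x, by simpa using hx⟩
    · simpa [← h2] using hk.eq_or_eq_opp (π x) (π y)
    · simpa [← h1] using hk.key_rot_lt (π x)

end Conj

namespace Cover

variable {r g n : ℕ} {μ : Fin n → ℕ} {s : ℕ} {S : Type} [DecidableEq S]

theorem ext_of {C C' : Cover r g μ s S} (h1 : C.zero = C'.zero) (h2 : C.simple = C'.simple)
    (h3 : C.infty = C'.infty) (h4 : C.pt = C'.pt) : C = C' := by
  obtain ⟨a, b, c, _, _, _, _, d, _, _, _, _⟩ := C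
  obtain ⟨a', b', c', _, _, _, _, d', _, _, _, _⟩ := C'
  dsimp only at h1 h2 h3 h4
  subst h1 h2 h3 h4
  rfl

theorem IsIso.unique {π : Perm S} {C C₁ C₂ : Cover r g μ s S} (h : IsIso π C C₁)
    (k : IsIso π C C₂) : C₁ = C₂ := by
  obtain ⟨h1, h2, h3, h4⟩ := h
  obtain ⟨k1, k2, k3, k4⟩ := k
  refine ext_of (Equiv.ext fun x => ?_) (funext fun a => Equiv.ext fun x => ?_)
    (Equiv.ext fun x => ?_) (funext fun x => ?_)
  · obtain ⟨x, rfl⟩ := π.surjective x; rw [← h1, k1]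
  · obtain ⟨x, rfl⟩ := π.surjective x; rw [← h2, k2]
  · obtain ⟨x, rfl⟩ := π.surjective x; rw [← h3, k3]
  · obtain ⟨x, rfl⟩ := π.surjective x; rw [← h4, k4]

theorem IsIso.inv {π : Perm S} {C C' : Cover r g μ s S} (h : IsIso π C C') :
    IsIso π⁻¹ C' C := by
  obtain ⟨h1, h2, h3, h4⟩ := h
  refine ⟨fun x => ?_, fun a x => ?_, fun x => ?_, fun x => ?_⟩
  · rw [Perm.inv_eq_iff_eq, h1]; simp
  · rw [Perm.inv_eq_iff_eq, h2]; simp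
  · rw [Perm.inv_eq_iff_eq, h3]; simp
  · rw [h4]; simp

theorem IsIso.mul {π ρ : Perm S} {C C' C'' : Cover r g μ s S} (h : IsIso π C C')
    (k : IsIso ρ C' C'') : IsIso (ρ * π) C C'' := by
  obtain ⟨h1, h2, h3, h4⟩ := h
  obtain ⟨k1, k2, k3, k4⟩ := k
  exact ⟨fun x => by simp [h1, k1], fun a x => by simp [h2, k2],
    fun x => by simp [h3, k3], fun x => by simp [h4, k4]⟩

/-- Transport of a cover along a permutation of the sheets. -/
def conj (C : Cover r g μ s S) (π : Perm S) : Cover r g μ s S where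
  zero := π * C.zero * π⁻¹
  simple a := π * C.simple a * π⁻¹
  infty := π * C.infty * π⁻¹
  prod_eq_one := by
    have h : (List.ofFn fun a => π * C.simple a * π⁻¹).prod =
        π * (List.ofFn C.simple).prod * π⁻¹ := by
      have := (map_list_prod (MulAut.conj π) (List.ofFn C.simple)).symm
      rwa [List.map_ofFn] at this
    rw [h]
    calc _ = π * (C.zero * (List.ofFn C.simple).prod * C.infty) * π⁻¹ := by group
      _ = 1 := by rw [C.prod_eq_one]; group
  connected := transitive_conj π (by
    rintro t ((rfl | rfl) | ⟨a, rfl⟩)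
    · exact Or.inl (Or.inl rfl)
    · exact Or.inl (Or.inr rfl)
    · exact Or.inr ⟨a, rfl⟩) C.connected
  card_zero x := by
    refine Eq.trans (Nat.card_congr (Equiv.subtypeEquiv π fun y => ?_)).symm (C.card_zero (π⁻¹ x))
    rw [Perm.sameCycle_conj]
    simp
  isSwap_simple a := by
    obtain ⟨x, y, hxy, h⟩ := C.isSwap_simple a
    exact ⟨π x, π y, by simpa using hxy, by rw [h, Equiv.swap_apply_apply]⟩
  pt x := C.pt (π⁻¹ x)
  pt_surjective := C.pt_surjective.comp π⁻¹.surjective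
  pt_eq_iff x y := by rw [C.pt_eq_iff, Perm.sameCycle_conj]
  card_pt i := by
    refine Eq.trans (Nat.card_congr (Equiv.subtypeEquiv π fun y => ?_)).symm (C.card_pt i)
    simp
  riemann_hurwitz := by
    simp only [card_cycles_conj]
    exact C.riemann_hurwitz

theorem isIso_conj (C : Cover r g μ s S) (π : Perm S) : IsIso π C (C.conj π) :=
  ⟨fun x => by simp [conj], fun a x => by simp [conj], fun x => by simp [conj],
    fun x => by simp [conj]⟩

end Cover

/-! ### Graphs and covers -/

section Correspondence

variable {r g n s : ℕ} {μ : Fin n → ℕ} {X S : Type}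

/-- The items of the graph that belongs to a monodromy: one dot for every sheet and, for every
label, one half-edge for each of the two sheets which the monodromy exchanges. -/
abbrev Items (simple : Fin s → Perm S) : Type :=
  {p : S × ℕ // p.2 ≠ 0 → tau simple p.2 p.1 ≠ p.1}

theorem card_ne_of_isSwap [DecidableEq S] [Finite S] {τ : Perm S} (h : τ.IsSwap) :
    Nat.card {b // τ b ≠ b} = 2 := by
  have := Fintype.ofFinite S
  rw [← Perm.card_support_eq_two.2 h, Nat.card_eq_fintype_card, Fintype.card_subtype]
  rfl

/-- The items are the dots and the half-edges. -/
noncomputable def itemsEquiv (simple : Fin s → Perm S) :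
    S ⊕ (Σ a, {b // simple a b ≠ b}) ≃ Items simple :=
  Equiv.ofBijective
    (Sum.elim (fun d => ⟨(d, 0), fun h => absurd rfl h⟩)
      fun p => ⟨(p.2.1, p.1 + 1), fun _ => by rw [tau_succ]; exact p.2.2⟩) <| by
    constructor
    · rintro (d | ⟨a, b, hb⟩) (d' | ⟨a', b', hb'⟩) h
      · simpa using h
      · simp at h
      · simp at h
      · simp only [Sum.elim_inr, Subtype.mk.injEq, Prod.mk.injEq, Nat.add_right_cancel_iff] at h
        obtain ⟨rfl, h⟩ := h
        obtain rfl := Fin.ext h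
        rfl
    · rintro ⟨⟨b, k⟩, h⟩
      by_cases hk : k = 0
      · subst hk
        exact ⟨Sum.inl b, rfl⟩
      · obtain ⟨a, rfl⟩ := exists_eq_succ_of_tau_ne (h hk)
        exact ⟨Sum.inr ⟨a, b, by simpa only [tau_succ] using h hk⟩, rfl⟩

instance [Finite S] (simple : Fin s → Perm S) : Finite (Items simple) :=
  Finite.of_equiv _ (itemsEquiv simple)

theorem card_items [DecidableEq S] [Finite S] {simple : Fin s → Perm S}
    (hs : ∀ a, (simple a).IsSwap) : Nat.card (Items simple) = 2 * s + Nat.card S := by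
  rw [← Nat.card_congr (itemsEquiv simple), Nat.card_sum, Nat.card_sigma]
  simp only [fun a => card_ne_of_isSwap (hs a)]
  simp
  ring

theorem card_cycles_of_label {f : Perm S} {pt : S → Fin n} (h1 : Function.Surjective pt)
    (h2 : ∀ x y, pt x = pt y ↔ f.SameCycle x y) : Nat.card (Cycles f) = n := by
  refine (Nat.card_congr (Equiv.ofBijective
    (Quotient.lift pt fun x y h => (h2 x y).2 h) ⟨?_, ?_⟩)).trans (Nat.card_fin n)
  · intro p q
    induction p, q using Quotient.inductionOn₂ with
    | h x y => exact fun h => Quotient.sound ((h2 x y).1 h)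
  · intro i
    obtain ⟨x, rfl⟩ := h1 i
    exact ⟨Quotient.mk _ x, rfl⟩

/-- Each simple branch point contributes 1 and `infty` has `n` cycles; the number of sheets cancels,
leaving vertices minus edges plus faces. -/
theorem hasGenus_iff_riemann_hurwitz [Finite S] [DecidableEq S] {G : DottedGraph n X}
    {simple : Fin s → Perm S} {zero infty : Perm S} {pt : S → Fin n}
    (hs : ∀ a, (simple a).IsSwap) (h1 : Function.Surjective pt)
    (h2 : ∀ x y, pt x = pt y ↔ infty.SameCycle x y) (hE : Nat.card G.Edge = s)
    (hF : Nat.card G.Face = Nat.card (Cycles zero)) :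
    G.HasGenus g ↔ 2 - 2 * (g : ℤ) = 2 * (Nat.card S : ℤ)
      - ((Nat.card S : ℤ) - (Nat.card (Cycles zero) : ℤ))
      - (∑ a, ((Nat.card S : ℤ) - (Nat.card (Cycles (simple a)) : ℤ)))
      - ((Nat.card S : ℤ) - (Nat.card (Cycles infty) : ℤ)) := by
  have h3 : ∀ a, (Nat.card S : ℤ) - (Nat.card (Cycles (simple a)) : ℤ) = 1 := fun a => by
    rw [← card_cycles_of_isSwap (hs a)]
    push_cast
    ring
  simp only [h3]
  rw [DottedGraph.HasGenus, hE, hF, card_cycles_of_label h1 h2]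
  simp only [Finset.sum_const, Finset.card_univ, Fintype.card_fin, nsmul_eq_mul, mul_one]
  omega

theorem HurwitzGraph.ext_of {G G' : HurwitzGraph r g μ X} (h1 : G.rot = G'.rot)
    (h2 : G.opp = G'.opp) (h3 : G.vert = G'.vert) : G = G' := by
  obtain ⟨⟨a, b, _, c, _, _, _⟩, _, _, _, _⟩ := G
  obtain ⟨⟨a', b', _, c', _, _, _⟩, _, _, _, _⟩ := G'
  dsimp only at h1 h2 h3
  subst h1 h2 h3
  rfl

instance [Finite X] : Finite (HurwitzGraph r g μ X) :=
  Finite.of_injective (fun G => (G.rot, G.opp, G.vert)) fun G G' h => by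
    simp only [Prod.mk.injEq] at h
    exact HurwitzGraph.ext_of h.1 h.2.1 h.2.2

instance [Finite X] (G : DottedGraph n X) : Finite {key : X → ℕ // IsKey G s key} :=
  Finite.of_injective (fun key x => (⟨key.1 x, Nat.lt_succ_of_le (key.2.le x)⟩ : Fin (s + 1)))
    fun _ _ h => Subtype.ext (funext fun x => congrArg Fin.val (congrFun h x))

/-- A Hurwitz graph with labelled edges and dots. -/
abbrev LabelledGraph (r g : ℕ) {n : ℕ} (μ : Fin n → ℕ) (s : ℕ) (X S : Type) : Type :=
  Σ G : HurwitzGraph r g μ X,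
    {key : X → ℕ // IsKey G.toDottedGraph s key} × (S ≃ {x // G.IsDot x})

/-- A cover together with names for the items of its graph. -/
abbrev LabelledCover (r g : ℕ) {n : ℕ} (μ : Fin n → ℕ) (s : ℕ) (X S : Type) [DecidableEq S] :
    Type :=
  Σ C : Cover r g μ s S, X ≃ Items C.simple

/-- The labelled graph `p` is the one of the cover `q`. -/
def Corresponds [DecidableEq S] (p : LabelledGraph r g μ s X S) (q : LabelledCover r g μ s X S) :
    Prop :=
  Compat p.1.rot p.1.opp p.2.1.1 (fun d => p.2.2 d) q.1.simple q.1.infty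
      (fun x => (q.2 x).1.1) ∧
    (∀ x, (q.2 x).1.2 = p.2.1.1 x) ∧ ∀ x, p.1.vert x = q.1.pt (q.2 x).1.1

theorem exists_cover [DecidableEq S] [Finite S] [Finite X] (p : LabelledGraph r g μ s X S) :
    ∃ q : LabelledCover r g μ s X S, Corresponds p q := by
  obtain ⟨G, ⟨key, hk⟩, ι⟩ := p
  obtain ⟨simple, infty, base, hs, c⟩ := exists_monodromy G.toDottedGraph hk ι
  -- The monodromy at `0` is forced by the product relation.
  have hz : infty⁻¹ * (List.ofFn simple).prod⁻¹ * (List.ofFn simple).prod * infty = 1 := by group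
  have hvert : ∀ x, G.vert x = G.vert (ι (base x)) := fun x => by
    rw [G.vert_eq_iff, c.sameCycle_rot_iff, c.base_dot]
  have hsurj : Function.Surjective fun d => G.vert (ι d) := fun i => by
    obtain ⟨x, hx⟩ := G.vert_surjective i
    exact ⟨base x, (hvert x).symm.trans hx⟩
  have hpt : ∀ d d', G.vert (ι d) = G.vert (ι d') ↔ infty.SameCycle d d' := fun d d' => by
    rw [G.vert_eq_iff, c.sameCycle_rot_iff, c.base_dot d, c.base_dot d']
  let C : Cover r g μ s S :=
    { zero := infty⁻¹ * (List.ofFn simple).prod⁻¹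
      simple := simple
      infty := infty
      prod_eq_one := hz
      connected := (c.transitive_iff hz).1 G.connected
      card_zero := fun d => by
        refine Eq.trans (c.card_dots_eq fun d' => ?_).symm (G.dots_face (ι d))
        refine (c.sameCycle_face_iff hs hz _ _).trans ?_
        rw [c.sheet_dot d, c.sheet_dot d']
      isSwap_simple := hs
      pt := fun d => G.vert (ι d)
      pt_surjective := hsurj
      pt_eq_iff := hpt
      card_pt := fun i =>
        Eq.trans (c.card_dots_eq (p := fun x => G.vert x = i) fun d' => Iff.rfl).symm
          (G.dots_vert i)
      riemann_hurwitz := (hasGenus_iff_riemann_hurwitz hs hsurj hpt hk.card_edge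
        (c.card_cycles_face hs hz)).1 G.hasGenus }
  have he : Function.Bijective fun x => (⟨(base x, key x), c.tau_ne x⟩ : Items simple) := by
    constructor
    · intro x y h
      simp only [Subtype.mk.injEq, Prod.mk.injEq] at h
      exact c.inj _ _ h.1 h.2
    · rintro ⟨⟨b, k⟩, h⟩
      by_cases hk : k = 0
      · subst hk
        exact ⟨ι b, Subtype.ext (Prod.ext (c.base_dot b) (c.key_dot b))⟩
      · obtain ⟨x, rfl, rfl⟩ := c.exists_item b k (h hk)
        exact ⟨x, rfl⟩
  exact ⟨⟨C, Equiv.ofBijective _ he⟩, c, fun _ => rfl, hvert⟩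

/-- The names `e` give each item its sheet and label, from which `exists_rotation` builds the graph.
The condition on edges met twice by a face comes for free from the labels. -/
theorem exists_graph [DecidableEq S] [Finite S] [Finite X] (q : LabelledCover r g μ s X S) :
    ∃ p : LabelledGraph r g μ s X S, Corresponds p q := by
  obtain ⟨C, e⟩ := q
  have hs := C.isSwap_simple
  have hz := C.prod_eq_one
  obtain ⟨ι, hι⟩ : ∃ ι : S → X, ∀ d, (e (ι d)).1 = (d, 0) :=
    ⟨fun d => e.symm ⟨(d, 0), fun h => absurd rfl h⟩, fun d => by simp⟩
  obtain ⟨rot, opp, c⟩ := exists_rotation (base := fun x => (e x).1.1) (key := fun x => (e x).1.2)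
    (ι := ι) hs C.infty
    (fun x y h1 h2 => e.injective (Subtype.ext (Prod.ext h1 h2)))
    (fun b k h => ⟨e.symm ⟨(b, k), fun _ => h⟩, by simp, by simp⟩)
    (fun x hx => (e x).2 hx) (fun d => by simp [hι]) (fun d => by simp [hι])
  let D : DottedGraph n X :=
    { rot := rot
      opp := opp
      opp_opp := c.opp_opp hs
      vert := fun x => C.pt (e x).1.1
      vert_surjective := fun i => by
        obtain ⟨d, hd⟩ := C.pt_surjective i
        exact ⟨ι d, (congrArg C.pt (c.base_dot d)).trans hd⟩
      vert_eq_iff := fun x y => by rw [C.pt_eq_iff, c.sameCycle_rot_iff]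
      connected := (c.transitive_iff hz).2 C.connected }
  have hk : IsKey D s fun x => (e x).1.2 := Compat.isKey (G := D) c hs
  have hface : ∀ x, Nat.card {y // D.IsDot y ∧ D.face.SameCycle x y} = r := fun x => by
    refine Eq.trans (c.card_dots_eq fun d' => ?_) (C.card_zero (c.sheet x))
    refine (c.sameCycle_face_iff hs hz _ _).trans ?_
    rw [c.sheet_dot d']
  let G : HurwitzGraph r g μ X :=
    { D with
      hasGenus := (hasGenus_iff_riemann_hurwitz hs C.pt_surjective C.pt_eq_iff hk.card_edge
        (c.card_cycles_face hs hz)).2 C.riemann_hurwitz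
      dots_face := hface
      dots_vert := fun i => by
        refine Eq.trans (c.card_dots_eq fun d => ?_) (C.card_pt i)
        change C.pt (e (ι d)).1.1 = i ↔ _
        rw [c.base_dot d]
      dots_between := fun x k hx hk hmin => c.dots_between hs (hface x) hx hk hmin }
  have hdot : ∀ x, (e x).1.2 = 0 ↔ D.IsDot x := hk.eq_zero_iff
  have hb : Function.Bijective fun d => (⟨ι d, (hdot _).1 (c.key_dot d)⟩ : {x // G.IsDot x}) := by
    constructor
    · intro d d' h
      rw [← c.base_dot d, ← c.base_dot d', Subtype.mk.inj h]
    · rintro ⟨x, hx⟩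
      exact ⟨_, Subtype.ext (c.dot_base ((hdot x).2 hx))⟩
  exact ⟨⟨G, ⟨_, hk⟩, Equiv.ofBijective _ hb⟩, c, fun _ => rfl, fun _ => rfl⟩

theorem Corresponds.graph_unique [DecidableEq S] {p p' : LabelledGraph r g μ s X S}
    {q : LabelledCover r g μ s X S} (h : Corresponds p q) (h' : Corresponds p' q) : p = p' := by
  obtain ⟨G, ⟨key, hk⟩, ι⟩ := p
  obtain ⟨G', ⟨key', hk'⟩, ι'⟩ := p'
  obtain ⟨C, e⟩ := q
  obtain ⟨c, h1, h2⟩ := h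
  obtain ⟨c', h1', h2'⟩ := h'
  dsimp only at c h1 h2 c' h1' h2'
  obtain rfl : key = key' := funext fun x => (h1 x).symm.trans (h1' x)
  obtain ⟨h3, h4, h5⟩ := c.rotation_eq c'
  obtain rfl : G = G' :=
    HurwitzGraph.ext_of h3 h4 (funext fun x => (h2 x).trans (h2' x).symm)
  obtain rfl : ι = ι' := Equiv.ext fun d => Subtype.ext (congrFun h5 d)
  rfl

theorem Corresponds.cover_unique [DecidableEq S] {p : LabelledGraph r g μ s X S}
    {q q' : LabelledCover r g μ s X S} (h : Corresponds p q) (h' : Corresponds p q') :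
    q = q' := by
  obtain ⟨G, ⟨key, hk⟩, ι⟩ := p
  obtain ⟨C, e⟩ := q
  obtain ⟨C', e'⟩ := q'
  obtain ⟨c, h1, h2⟩ := h
  obtain ⟨c', h1', h2'⟩ := h'
  dsimp only at c h1 h2 c' h1' h2'
  obtain ⟨h3, h4, h5⟩ := c.monodromy_eq c'
  have hz : ∀ C : Cover r g μ s S, C.zero = ((List.ofFn C.simple).prod * C.infty)⁻¹ := fun C =>
    eq_inv_of_mul_eq_one_left (by rw [← mul_assoc]; exact C.prod_eq_one)
  have h6 : C.zero = C'.zero := by rw [hz, hz, h4, h5]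
  obtain rfl : C = C' := by
    refine Cover.ext_of h6 h4 h5 (funext fun d => ?_)
    have h7 := h2 (ι d)
    rw [h2' (ι d), c.base_dot d, c'.base_dot d] at h7
    exact h7.symm
  obtain rfl : e = e' := Equiv.ext fun x =>
    Subtype.ext (Prod.ext (congrFun h3 x) ((h1 x).trans (h1' x).symm))
  rfl

/-! ### Counting with all dots and items named -/

theorem card_labelledGraph_eq [DecidableEq S] [Finite S] [Finite X] :
    Nat.card (LabelledGraph r g μ s X S) = Nat.card (LabelledCover r g μ s X S) :=
  card_eq_of_relation Corresponds exists_cover exists_graph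
    (fun _ _ _ h h' => h.graph_unique h') fun _ _ _ h h' => h.cover_unique h'

/-- The items of every cover can be named in the same number of ways, since two half-edges per
transposition and one dot per sheet give `2s + d` items. -/
theorem card_labelledCover [DecidableEq S] [Finite S] [Finite X]
    (hX : Nat.card X = 2 * s + Nat.card S) :
    Nat.card (LabelledCover r g μ s X S) =
      Nat.card (Cover r g μ s S) * (Nat.card X).factorial := by
  have := Fintype.ofFinite (Cover r g μ s S)
  have h : ∀ C : Cover r g μ s S, Nat.card (X ≃ Items C.simple) = (Nat.card X).factorial := by
    intro C
    obtain ⟨e⟩ : Nonempty (X ≃ Items C.simple) := Finite.card_eq.1 (by rw [hX, card_items C.isSwap_simple])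
    rw [Nat.card_congr (Equiv.equivCongr (Equiv.refl X) e.symm), Nat.card_perm]
  rw [Nat.card_sigma]
  simp [h]

theorem HurwitzGraph.card_dots [Finite X] (G : HurwitzGraph r g μ X) :
    Nat.card {x // G.IsDot x} = ∑ i, μ i := by
  have e : {x // G.IsDot x} ≃ Σ i, {x // G.IsDot x ∧ G.vert x = i} :=
    { toFun := fun x => ⟨G.vert x, x, x.2, rfl⟩
      invFun := fun p => ⟨p.2.1, p.2.2.1⟩
      left_inv := fun _ => rfl
      right_inv := by rintro ⟨_, x, hx, rfl⟩; rfl }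
  rw [Nat.card_congr e, Nat.card_sigma]
  simp only [G.dots_vert]

theorem card_labelledGraph [Finite S] [Finite X] (hS : Nat.card S = ∑ i, μ i) :
    Nat.card (LabelledGraph r g μ s X S) =
      (∑ᶠ G : HurwitzGraph r g μ X, Nat.card {key : X → ℕ // IsKey G.toDottedGraph s key}) *
        (Nat.card S).factorial := by
  have := Fintype.ofFinite (HurwitzGraph r g μ X)
  have h : ∀ G : HurwitzGraph r g μ X,
      Nat.card (S ≃ {x // G.IsDot x}) = (Nat.card S).factorial := by
    intro G
    obtain ⟨e⟩ : Nonempty (S ≃ {x // G.IsDot x}) := Finite.card_eq.1 (by rw [hS, G.card_dots])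
    rw [Nat.card_congr (Equiv.equivCongr (Equiv.refl S) e.symm), Nat.card_perm]
  rw [Nat.card_sigma, finsum_eq_sum_of_fintype, Finset.sum_mul]
  simp only [Nat.card_prod, h]

/-- The arrows can be chosen in `∏ i, μ i` ways. -/
theorem finsum_arrowedGraph [Finite X] (f : HurwitzGraph r g μ X → ℕ) :
    ∑ᶠ G : ArrowedGraph r g μ X, f G.toHurwitzGraph =
      (∏ i, μ i) * ∑ᶠ G : HurwitzGraph r g μ X, f G := by
  classical
  have := Fintype.ofFinite (HurwitzGraph r g μ X)
  have := Fintype.ofFinite (ArrowedGraph r g μ X)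
  have := Fintype.ofFinite X
  let e : ArrowedGraph r g μ X ≃
      Σ G : HurwitzGraph r g μ X, ∀ i, {x // G.IsDot x ∧ G.vert x = i} :=
    { toFun := fun G => ⟨G.toHurwitzGraph, fun i => ⟨G.arrow i, G.arrow_isDot i, G.vert_arrow i⟩⟩
      invFun := fun p => ⟨p.1, fun i => p.2 i, fun i => (p.2 i).2.1, fun i => (p.2 i).2.2⟩
      left_inv := fun _ => rfl
      right_inv := fun _ => rfl }
  rw [finsum_eq_sum_of_fintype, finsum_eq_sum_of_fintype,
    Fintype.sum_equiv e (fun G => f G.toHurwitzGraph) (fun p => f p.1) fun _ => rfl, Fintype.sum_sigma, Finset.mul_sum]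
  refine Finset.sum_congr rfl fun G _ => ?_
  change ∑ _, f G = _
  rw [Finset.sum_const, smul_eq_mul, Finset.card_univ, ← Nat.card_eq_fintype_card, Nat.card_pi]
  simp only [G.dots_vert]

end Correspondence

/-! ### The weighted numbers as counts of structures on a fixed set -/

theorem graphNumber_eq (r g : ℕ) {n : ℕ} (μ : Fin n → ℕ) :
    graphNumber r g μ =
      (∏ i, (μ i : ℚ)) *
        ((∑ᶠ G : HurwitzGraph r g μ (Fin (2 * edgeNumber r g μ + ∑ i, μ i)),
          Nat.card {key // IsKey G.toDottedGraph (edgeNumber r g μ) key} : ℕ) : ℚ) /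
        ((2 * edgeNumber r g μ + ∑ i, μ i).factorial : ℚ) /
        ((edgeNumber r g μ).factorial : ℚ) := by
  set s := edgeNumber r g μ with hs
  set N := 2 * s + ∑ i, μ i with hN
  -- All permutations of the `N` items act, and the number of labellings is constant on isomorphism
  -- classes.
  have key := finsum_quotient_div_card_aut (ArrowedGraph.isoSetoid r g μ (Fin N))
    ArrowedGraph.IsIso (fun _ _ => Iff.rfl) (fun π G => ⟨_, G.isIso_conj π⟩)
    (fun _ _ _ _ h h' => h.unique h') (fun _ _ _ h => h.inv) (fun _ _ _ _ _ h h' => h.mul h')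
    (fun G => (Nat.card {key // IsKey G.toDottedGraph s key} : ℚ))
    (fun π G G' h => by simp only [h.card_isKey_eq s])
  have hsum : (∑ᶠ G : ArrowedGraph r g μ (Fin N),
      (Nat.card {key // IsKey G.toDottedGraph s key} : ℚ)) =
        (∏ i, (μ i : ℚ)) * ((∑ᶠ G : HurwitzGraph r g μ (Fin N),
          Nat.card {key // IsKey G.toDottedGraph s key} : ℕ) : ℚ) := by
    have h := finsum_arrowedGraph (r := r) (g := g) (μ := μ) (X := Fin N)
      fun G => Nat.card {key // IsKey G.toDottedGraph s key}
    have := Fintype.ofFinite (ArrowedGraph r g μ (Fin N))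
    rw [finsum_eq_sum_of_fintype] at h ⊢
    exact_mod_cast h
  rw [hsum, Nat.card_perm, Nat.card_fin] at key
  rw [← key, graphNumber, ← hs, ← hN]
  have := Fintype.ofFinite (Quotient (ArrowedGraph.isoSetoid r g μ (Fin N)))
  rw [finsum_eq_sum_of_fintype, finsum_eq_sum_of_fintype, Finset.sum_div]
  refine Finset.sum_congr rfl fun c _ => ?_
  rw [card_edgeLabeling, div_div]
  rfl

theorem hurwitzNumber_eq (r g : ℕ) {n : ℕ} (μ : Fin n → ℕ) :
    hurwitzNumber r g μ =
      (Nat.card (Cover r g μ (edgeNumber r g μ) (Fin (∑ i, μ i))) : ℚ) /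
        ((∑ i, μ i).factorial : ℚ) / ((edgeNumber r g μ).factorial : ℚ) := by
  set s := edgeNumber r g μ with hs
  have key := finsum_quotient_div_card_aut (Cover.isoSetoid r g μ s (Fin (∑ i, μ i)))
    Cover.IsIso (fun _ _ => Iff.rfl) (fun π C => ⟨_, C.isIso_conj π⟩)
    (fun _ _ _ _ h h' => h.unique h') (fun _ _ _ h => h.inv) (fun _ _ _ _ _ h h' => h.mul h')
    (fun _ => 1) (fun _ _ _ _ => rfl)
  have := Fintype.ofFinite (Cover r g μ s (Fin (∑ i, μ i)))
  rw [finsum_eq_sum_of_fintype (fun _ : Cover r g μ s (Fin (∑ i, μ i)) => (1 : ℚ)),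
    Nat.card_perm, Nat.card_fin, Finset.sum_const, Finset.card_univ, nsmul_eq_mul, mul_one,
    ← Nat.card_eq_fintype_card] at key
  rw [← key, hurwitzNumber, ← hs]
  rfl

end OrbifoldHurwitz

theorem mainTheorem4 (r g n : ℕ) (hr : 0 < r) (hn : 0 < n) (μ : Fin n → ℕ)
    (hμ : ∀ i, 0 < μ i) :
    OrbifoldHurwitz.graphNumber r g μ =
      (∏ i, (μ i : ℚ)) * OrbifoldHurwitz.hurwitzNumber r g μ := by
  rw [OrbifoldHurwitz.graphNumber_eq, OrbifoldHurwitz.hurwitzNumber_eq]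
  -- After the rewriting below, `h` equates the sum over graphs of their numbers of labellings,
  -- times `d!`, with the number of covers times `(2s+d)!`; dividing by both factorials gives the
  -- claim.
  have h := OrbifoldHurwitz.card_labelledGraph_eq (r := r) (g := g) (μ := μ)
    (s := OrbifoldHurwitz.edgeNumber r g μ) (S := Fin (∑ i, μ i))
    (X := Fin (2 * OrbifoldHurwitz.edgeNumber r g μ + ∑ i, μ i))
  rw [OrbifoldHurwitz.card_labelledCover (by simp), OrbifoldHurwitz.card_labelledGraph (by simp),
    Nat.card_fin, Nat.card_fin] at h
  have h' := congrArg (Nat.cast : ℕ → ℚ) h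
  rw [Nat.cast_mul, Nat.cast_mul] at h'
  have h1 := Nat.cast_ne_zero (R := ℚ).2 (∑ i, μ i).factorial_ne_zero
  have h2 := Nat.cast_ne_zero (R := ℚ).2
    (2 * OrbifoldHurwitz.edgeNumber r g μ + ∑ i, μ i).factorial_ne_zero
  rw [mul_div_assoc, (div_eq_div_iff h2 h1).2 h', mul_div_assoc]
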